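/- All graphs are finite, simple and undirected. For $t\ge 1$ let $U_t$ be the graph obtained from a path on $t$ vertices by adding a vertex adjacent to all of them. For an integer $K\ge 1$, a $K$-fat minor model of a graph $H$ in a graph $G$ is a family of connected (nonempty) subgraphs $(B_v)_{v\in V(H)}$, $(P_e)_{e\in E(H)}$ of $G$ such that $V(B_v)\cap V(P_e)\ne\emptyset$ whenever $v$ is an end-vertex of $e$, and any two other distinct members of the family are at distance at least $K$ in $G$ (vertices in different components are at infinite distance). A class $\mathcal G$ of graphs is $H$-asymptotic minor-free if there is an integer $K\ge 1$ such that no graph in $\mathcal G$ has a $K$-fat minor model of $H$. A path of $G$ is isometric if it is a shortest path of $G$ between its end-vertices (single vertices are allowed). An isometric path cover of $G$ is a collection of isometric paths of $G$ such that each vertex of $G$ lies on at least one of them; Isometric Path Cover asks for one with the minimum number of paths. **Corollary.** Isometric Path Cover admits a polynomial-time constant-factor approximation algorithm on $U_t$-asymptotic minor-free graphs, for all $t\ge 1$. That is, for every $t\ge 1$ and every $U_t$-asymptotic minor-free class $\mathcal G$ of graphs there are a constant $c$ (depending on $\mathcal G$ only), a polynomial $p$ and a deterministic algorithm (a program of a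 unit-cost random access machine with addition and truncated subtraction, which is given the adjacency matrix of the input graph) that, for each $n$ and each graph $G\in\mathcal G$ with $n$ vertices, halts after at most $p(n)$ steps and outputs an isometric path cover of $G$ with at most $c$ times the minimum number of paths in an isometric path cover of $G$. -/

import Mathlib

/-! ### Graphs: the graphs `U_t`, fat minors, asymptotic minors -/

/-- The graph `U_t`: a path on the `t` vertices `some 0, …, some (t - 1)`, together with a
universal vertex `none`. -/
def uGraph (t : ℕ) : SimpleGraph (Option (Fin t)) where
  Adj
    | none, none => False
    | none, some _ => True
    | some _, none => True
    | some i, some j => (SimpleGraph.pathGraph t).Adj i j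
  symm := ⟨by
    rintro (_ | i) (_ | j) h
    · exact h
    · trivial
    · trivial
    · exact SimpleGraph.Adj.symm h⟩
  loopless := ⟨by
    rintro (_ | i) h
    · exact h
    · exact SimpleGraph.irrefl _ h⟩

/-- The distance in `G` between (the vertex sets of) the subgraphs `X` and `Y` is at least `K`.
Vertices in different components are at distance `⊤`. -/
def SubgraphDistGE {V : Type*} (G : SimpleGraph V) (K : ℕ) (X Y : G.Subgraph) : Prop :=
  ∀ x ∈ X.verts, ∀ y ∈ Y.verts, (K : ℕ∞) ≤ G.edist x y

/-- A `K`-fat minor model of `H` in `G`: connected (in particular nonempty) subgraphs of `G`, one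
for each vertex and one for each edge of `H`, such that the subgraph of a vertex meets the subgraph
of each edge incident with it, and any two other members are at distance at least `K` in `G`. -/
structure FatMinorModel {V W : Type*} (H : SimpleGraph W) (K : ℕ) (G : SimpleGraph V) where
  /-- the branch sets -/
  branchSet : W → G.Subgraph
  /-- the branch paths -/
  branchPath : H.edgeSet → G.Subgraph
  branchSet_connected : ∀ w, (branchSet w).Connected
  branchPath_connected : ∀ e, (branchPath e).Connected
  incident : ∀ (w : W) (e : H.edgeSet), w ∈ (e : Sym2 W) →
    ((branchSet w).verts ∩ (branchPath e).verts).Nonempty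
  far_sets : ∀ w w' : W, w ≠ w' → SubgraphDistGE G K (branchSet w) (branchSet w')
  far_paths : ∀ e e' : H.edgeSet, e ≠ e' → SubgraphDistGE G K (branchPath e) (branchPath e')
  far_set_path : ∀ (w : W) (e : H.edgeSet), w ∉ (e : Sym2 W) →
    SubgraphDistGE G K (branchSet w) (branchPath e)

/-- `H` is a `K`-fat minor of `G`. -/
def IsFatMinor {V W : Type*} (H : SimpleGraph W) (K : ℕ) (G : SimpleGraph V) : Prop :=
  Nonempty (FatMinorModel H K G)

/-- A class of finite simple graphs, each given on a vertex set `{0, …, n - 1}`. -/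
abbrev GraphClass : Type := (n : ℕ) → Set (SimpleGraph (Fin n))

/-- The class `𝒢` contains `H` as an asymptotic minor: for every `K ≥ 1` some member of `𝒢`
contains `H` as a `K`-fat minor. -/
def GraphClass.ContainsAsymptoticMinor (𝒢 : GraphClass) {W : Type*} (H : SimpleGraph W) : Prop :=
  ∀ K : ℕ, 1 ≤ K → ∃ n, ∃ G ∈ 𝒢 n, IsFatMinor H K G

/-- The class `𝒢` is `H`-asymptotic minor-free. -/
def GraphClass.AsymptoticMinorFree (𝒢 : GraphClass) {W : Type*} (H : SimpleGraph W) : Prop :=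
  ¬ 𝒢.ContainsAsymptoticMinor H

/-! ### Isometric path covers -/

/-- The vertex sequence `l` is an isometric path of `G`, that is, a shortest path of `G` between its
end-vertices (a single vertex is an isometric path of length `0`). -/
def IsIsometricPath {V : Type*} (G : SimpleGraph V) (l : List V) : Prop :=
  ∃ (u v : V) (p : G.Walk u v), p.IsPath ∧ p.length = G.dist u v ∧ p.support = l

/-- The members of `P` are isometric paths of `G`, and each vertex of `G` lies on one of them. -/
def IsIsometricPathCover {V : Type*} (G : SimpleGraph V) (P : List (List V)) : Prop :=
  (∀ l ∈ P, IsIsometricPath G l) ∧ ∀ v : V, ∃ l ∈ P, v ∈ l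

/-- `P` is an isometric path cover of `G` with at most `c` times as many paths as an isometric path
cover of minimum cardinality. -/
def IsApproxIsometricPathCover {V : Type*} (G : SimpleGraph V) (c : ℕ) (P : List (List V)) :
    Prop :=
  IsIsometricPathCover G P ∧ ∀ Q, IsIsometricPathCover G Q → P.length ≤ c * Q.length

/-! ### The machine model

Random access machines with unit cost whose only arithmetic is addition and truncated subtraction
(so that the numbers in use after `T` steps have `O(T + log N)` bits, where `N` bounds the numbers
in the input, and polynomial time has its usual meaning). Programs are structured. A program is a
finite object, so it mentions finitely many registers and finitely many memory arrays. -/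

namespace RAM

/-- The contents of the registers and of the memory arrays. -/
structure State where
  /-- `reg r` is the content of register `r` -/
  reg : ℕ → ℕ
  /-- `arr k i` is the content of cell `i` of the `k`-th memory array -/
  arr : ℕ → ℕ → ℕ

/-- Write `x` into register `r`. -/
def State.setReg (s : State) (r x : ℕ) : State :=
  { s with reg := Function.update s.reg r x }

/-- Write `x` into cell `i` of the `k`-th memory array. -/
def State.setArr (s : State) (k i x : ℕ) : State :=
  { s with arr := Function.update s.arr k (Function.update (s.arr k) i x) }

/-- Comparisons of two registers. -/
inductive Cond where
  | lt (a b : ℕ)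
  | eq (a b : ℕ)

/-- The comparison `c` holds in the state `s`. -/
def Cond.Holds : Cond → State → Prop
  | lt a b, s => s.reg a < s.reg b
  | eq a b, s => s.reg a = s.reg b

/-- Programs. -/
inductive Program where
  /-- do nothing -/
  | skip
  /-- `reg r := x`, for a constant `x` -/
  | const (r x : ℕ)
  /-- `reg r := reg a` -/
  | copy (r a : ℕ)
  /-- `reg r := reg a + reg b` -/
  | add (r a b : ℕ)
  /-- `reg r := max (reg a - reg b) 0` -/
  | sub (r a b : ℕ)
  /-- `reg r := arr k (reg a)` -/
  | load (r k a : ℕ)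
  /-- `arr k (reg a) := reg b` -/
  | store (k a b : ℕ)
  /-- `p`, then `q` -/
  | seq (p q : Program)
  /-- if `c` then `p` else `q` -/
  | ite (c : Cond) (p q : Program)
  /-- while `c` do `p` -/
  | loop (c : Cond) (p : Program)

/-- `Exec p s T s'`: the program `p`, started in the state `s`, halts after exactly `T` steps, in
the state `s'`. Each elementary instruction and each evaluation of a comparison is one step. -/
inductive Exec : Program → State → ℕ → State → Prop where
  | skip (s) : Exec .skip s 1 s
  | const (r x s) : Exec (.const r x) s 1 (s.setReg r x)
  | copy (r a s) : Exec (.copy r a) s 1 (s.setReg r (s.reg a))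
  | add (r a b s) : Exec (.add r a b) s 1 (s.setReg r (s.reg a + s.reg b))
  | sub (r a b s) : Exec (.sub r a b) s 1 (s.setReg r (s.reg a - s.reg b))
  | load (r k a s) : Exec (.load r k a) s 1 (s.setReg r (s.arr k (s.reg a)))
  | store (k a b s) : Exec (.store k a b) s 1 (s.setArr k (s.reg a) (s.reg b))
  | seq {p q s T s' T' s''} (hp : Exec p s T s') (hq : Exec q s' T' s'') :
      Exec (.seq p q) s (T + T') s''
  | ite_true {c p q s T s'} (hc : c.Holds s) (hp : Exec p s T s') :
      Exec (.ite c p q) s (T + 1) s'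
  | ite_false {c p q s T s'} (hc : ¬ c.Holds s) (hq : Exec q s T s') :
      Exec (.ite c p q) s (T + 1) s'
  | loop_stop {c p s} (hc : ¬ c.Holds s) : Exec (.loop c p) s 1 s
  | loop_step {c p s T s' T' s''} (hc : c.Holds s) (hp : Exec p s T s')
      (hl : Exec (.loop c p) s' T' s'') : Exec (.loop c p) s (T + 1 + T') s''

open Classical in
/-- The initial state on the input graph `G`: register `0` contains the number `n` of vertices,
array `0` contains the adjacency matrix of `G` in row-major order, everything else is `0`. -/
noncomputable def inputState {n : ℕ} (G : SimpleGraph (Fin n)) : State where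
  reg r := if r = 0 then n else 0
  arr k i :=
    if k = 0 ∧ ∃ u v : Fin n, i = (u : ℕ) * n + (v : ℕ) ∧ G.Adj u v then 1 else 0

/-- The list of vertex sequences represented by a final state: register `0` contains their number
`m`, and for `i < m` the `i`-th sequence is stored in array `2`, from the cell with index `arr 1 i`
(included) to the cell with index `arr 1 (i + 1)` (excluded). -/
def State.output (s : State) : List (List ℕ) :=
  (List.range (s.reg 0)).map fun i =>
    (List.range' (s.arr 1 i) (s.arr 1 (i + 1) - s.arr 1 i)).map (s.arr 2)

end RAM

/-- The program `A` is a polynomial-time `c`-approximation algorithm for Isometric Path Cover on the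
graphs in `𝒢`: on each input graph `G` in `𝒢`, with `n` vertices, `A` halts after a number of steps
that is at most a fixed polynomial in `n`, and the output is an isometric path cover of `G` with
at most `c` times the minimum number of paths. -/
def IsPolyTimeApproxIsometricPathCover (A : RAM.Program) (c : ℕ) (𝒢 : GraphClass) : Prop :=
  ∃ p : Polynomial ℕ, ∀ (n : ℕ), ∀ G ∈ 𝒢 n, ∃ (T : ℕ) (s : RAM.State),
    RAM.Exec A (RAM.inputState G) T s ∧ T ≤ p.eval n ∧
    ∃ P : List (List (Fin n)), IsApproxIsometricPathCover G c P ∧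
      s.output = P.map fun l => l.map fun v => (v : ℕ)

/-! ### Geodesics and antichains -/

/-! Choose a root in every component and say that x precedes y if x lies on a shortest path from the
root to y. A chain of this order lies on a single shortest path towards the root. A cover by chains
therefore gives an isometric path cover of the same size, valid in every graph. By the Dilworth and
König duality, a minimum chain cover is no larger than some antichain A. It remains to see that A
bounds every isometric path cover from below.

This is the only use of the excluded minor. Suppose that an isometric path f meets A in more than
(2K+1)(8t+2) vertices. For consecutive such vertices, the distance from the root r changes by
strictly less than their distance along f. Hence position plus and position minus distance from r
both increase along these vertices. Because of this, a shortest path from r to a vertex of A that is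
neither among the first 2K+1 nor among the last 2K+1 of them on f can come within K of f only near
that vertex. Shortest paths from r to t well-spaced vertices of A, cut where they come within K of
f, form a connected hub far from f. Short connectors join the hub to f at t distant places. This is
a K-fat model of `U_t` (`isFatMinor_uGraph_of_hub`, `isFatMinor_uGraph_of_antichain`). So each
isometric path contains at most (2K+1)(8t+2) elements of A, and this number is the approximation
ratio (`card_antichain_le_mul_length`).

A minimum chain cover comes from a maximum matching between two copies of the vertex set, where x on
the left is joined to each y above it on the right. The unmatched left vertices are the deepest
vertices of the chains. The matching is computed by an auction with integer prices, because its
optimality is read off from the final prices: a value missed by all prices separates off an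
antichain at least as large as the set of unmatched left vertices (`AuctionInv.exists_antichain`).

For the machine part, the algorithm is written in a small language whose loops all run n times. Its
compilation to the random access machine has polynomial cost by construction (`Code.compile_spec`),
so only functional correctness remains to be proved for each routine. -/

/-- `f 0, …, f L` is a shortest path of `G`. -/
structure IsGeodesicSeq {V : Type*} (G : SimpleGraph V) (f : ℕ → V) (L : ℕ) : Prop where
  adj : ∀ i < L, G.Adj (f i) (f (i + 1))
  dist_eq : ∀ i j, i ≤ j → j ≤ L → G.dist (f i) (f j) = j - i

section Geodesic

variable {V : Type*} {G : SimpleGraph V}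

theorem SimpleGraph.Walk.isGeodesicSeq {u v : V} (p : G.Walk u v) (hp : p.length = G.dist u v) :
    IsGeodesicSeq G p.getVert p.length := by
  refine ⟨fun i hi => p.adj_getVert_succ hi, fun i j hij hj => ?_⟩
  have h1 : G.dist u (p.getVert i) ≤ i := by
    refine (SimpleGraph.dist_le (p.take i)).trans ?_
    simp
  have h3 : G.dist (p.getVert j) v ≤ p.length - j := by
    refine (SimpleGraph.dist_le (p.drop j)).trans ?_
    simp
  have h2 : G.dist (p.getVert i) (p.getVert j) ≤ j - i := by
    have h := SimpleGraph.dist_le ((p.drop i).take (j - i))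
    have e : (p.drop i).getVert (j - i) = p.getVert j := by
      rw [SimpleGraph.Walk.drop_getVert, show i + (j - i) = j by omega]
    rw [← e]
    refine h.trans ?_
    simp
  have t1 := SimpleGraph.Reachable.dist_triangle_left (p.take i).reachable v
  have t2 := SimpleGraph.Reachable.dist_triangle_right (p.drop j).reachable (p.getVert i)
  omega

theorem SimpleGraph.Reachable.exists_isGeodesicSeq {a r : V} (h : G.Reachable a r) :
    ∃ f : ℕ → V, IsGeodesicSeq G f (G.dist a r) ∧ f 0 = a ∧ f (G.dist a r) = r := by
  obtain ⟨p, hp⟩ := h.exists_walk_length_eq_dist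
  refine ⟨p.getVert, hp ▸ p.isGeodesicSeq hp, by simp, by rw [← hp]; simp⟩

namespace IsGeodesicSeq

variable {f : ℕ → V} {L : ℕ}

theorem reachable (hf : IsGeodesicSeq G f L) {i j : ℕ} (hij : i ≤ j) (hj : j ≤ L) :
    G.Reachable (f i) (f j) := by
  induction j, hij using Nat.le_induction with
  | base => exact SimpleGraph.Reachable.rfl
  | succ j _ ih => exact (ih (by omega)).trans (hf.adj j (by omega)).reachable

theorem induce_image_Icc_connected (hf : IsGeodesicSeq G f L) {i j : ℕ} (hij : i ≤ j)
    (hj : j ≤ L) : (G.induce (f '' Set.Icc i j)).Connected := by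
  induction j, hij using Nat.le_induction with
  | base =>
    rw [Set.Icc_self, Set.image_singleton]
    exact SimpleGraph.connected_induce_iff.mpr
      (SimpleGraph.Subgraph.singletonSubgraph_connected (v := f i) |>.mono
        (SimpleGraph.singletonSubgraph_le_iff _ _ |>.mpr (by simp)) (by simp))
  | succ j hij ih =>
    have h1 := ih (by omega)
    have : f '' Set.Icc i (j + 1) = f '' Set.Icc i j ∪ {f j, f (j + 1)} := by
      rw [← Set.insert_Icc_right_eq_Icc_add_one (by omega), Set.image_insert_eq]
      ext x
      simp only [Set.mem_insert_iff, Set.mem_union, Set.mem_singleton_iff]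
      constructor
      · tauto
      · rintro (h | rfl | h)
        · exact Or.inr h
        · exact Or.inr ⟨j, ⟨hij, le_rfl⟩, rfl⟩
        · exact Or.inl h
    rw [this]
    refine SimpleGraph.induce_union_connected h1.preconnected
      (SimpleGraph.induce_pair_connected_of_adj (hf.adj j (by omega))).preconnected
      ⟨f j, ⟨j, ⟨hij, le_rfl⟩, rfl⟩, by simp⟩

end IsGeodesicSeq

/-- Fatness is stated with `edist`, the estimates with `dist`. The two differ on unreachable pairs,
where `dist` is 0 and `edist` is infinite. -/
theorem natCast_le_edist_of {K : ℕ} {x y : V} (h : G.Reachable x y → K ≤ G.dist x y) :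
    (K : ℕ∞) ≤ G.edist x y := by
  by_cases hr : G.Reachable x y
  · rw [← hr.coe_dist_eq_edist]
    exact_mod_cast h hr
  · rw [SimpleGraph.edist_eq_top_of_not_reachable hr]
    exact le_top

/-- The induced subgraph on `S`. -/
abbrev inducedOn (G : SimpleGraph V) (S : Set V) : G.Subgraph := (⊤ : G.Subgraph).induce S

theorem inducedOn_connected {S : Set V} (h : (G.induce S).Connected) :
    (inducedOn G S).Connected := SimpleGraph.connected_induce_iff.mp h

theorem subgraphDistGE_comm {K : ℕ} {X Y : G.Subgraph} (h : SubgraphDistGE G K X Y) :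
    SubgraphDistGE G K Y X := fun x hx y hy => by
  rw [SimpleGraph.edist_comm]
  exact h y hy x hx

/-! ### Fat models of `U_t` along a geodesic -/

theorem uGraph_edge_cases {t : ℕ} (e : (uGraph t).edgeSet) :
    (∃ j : Fin t, (e : Sym2 (Option (Fin t))) = s(none, some j)) ∨
    ∃ i j : Fin t, (i : ℕ) + 1 = j ∧ (e : Sym2 (Option (Fin t))) = s(some i, some j) := by
  obtain ⟨e, he⟩ := e
  induction e with
  | _ a b =>
    rw [SimpleGraph.mem_edgeSet] at he
    rcases a with _ | a <;> rcases b with _ | b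
    · exact he.elim
    · exact Or.inl ⟨b, rfl⟩
    · exact Or.inl ⟨a, Sym2.eq_swap⟩
    · have h : (SimpleGraph.pathGraph t).Adj a b := he
      rw [SimpleGraph.pathGraph_adj] at h
      rcases h with h | h
      · exact Or.inr ⟨a, b, h, rfl⟩
      · exact Or.inr ⟨b, a, h, Sym2.eq_swap⟩

/-- A geodesic, a connected hub far from it, and connected sets which lead from the hub to
points of the geodesic that are far apart make a fat minor. -/
theorem isFatMinor_uGraph_of_hub {f : ℕ → V} {L K t : ℕ} (hf : IsGeodesicSeq G f L)
    (q : Fin t → ℕ) (hqL : ∀ j, q j + 2 * K ≤ L) (hq : ∀ i j, i < j → q i + 8 * K ≤ q j)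
    (H : Set V) (hH : (G.induce H).Connected) (hHf : ∀ x ∈ H, ∀ i ≤ L, K ≤ G.dist x (f i))
    (T : Fin t → Set V) (hT : ∀ j, (G.induce (T j)).Connected) (hTH : ∀ j, (H ∩ T j).Nonempty)
    (hqT : ∀ j, f (q j) ∈ T j) (hTq : ∀ j, ∀ x ∈ T j, G.dist x (f (q j)) ≤ K) :
    IsFatMinor (uGraph t) K G := by
  -- Radius 2K keeps the connector `T j`, which stays within K of `f (q j)`, at distance K from the
  -- path edges: these consist of the pieces of f between the segments. Truncation of `q j - 2 * K`
  -- at 0 only shortens the segment on the left and does no harm.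
  set B : Fin t → Set V := fun j => f '' Set.Icc (q j - 2 * K) (q j + 2 * K) with hB
  have hS : ∀ e : (uGraph t).edgeSet, ∃ S : Set V,
      (∃ j : Fin t, (e : Sym2 (Option (Fin t))) = s(none, some j) ∧ S = T j) ∨
      ∃ i j : Fin t, (i : ℕ) + 1 = j ∧ (e : Sym2 (Option (Fin t))) = s(some i, some j) ∧
        S = f '' Set.Icc (q i + 2 * K) (q j - 2 * K) := fun e => by
    rcases uGraph_edge_cases e with ⟨j, hj⟩ | ⟨i, j, hij, h⟩
    · exact ⟨_, Or.inl ⟨j, hj, rfl⟩⟩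
    · exact ⟨_, Or.inr ⟨i, j, hij, h, rfl⟩⟩
  choose S hS using hS
  have hTr : ∀ j, ∀ x ∈ T j, G.Reachable (f (q j)) x := fun j x hx => by
    have := (hT j).preconnected ⟨_, hqT j⟩ ⟨x, hx⟩
    exact this.map (SimpleGraph.Embedding.induce _).toHom
  have hff : ∀ a b m, a ≤ L → b ≤ L → (a + m ≤ b ∨ b + m ≤ a) → m ≤ G.dist (f a) (f b) := by
    intro a b m ha hb h
    rcases le_total a b with hab | hab
    · rw [hf.dist_eq a b hab hb]; omega
    · rw [SimpleGraph.dist_comm, hf.dist_eq b a hab ha]; omega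
  -- Moving from `f (q j)` to a point of its connector costs at most K in all distances to f.
  have hTf : ∀ j, ∀ x ∈ T j, ∀ b m, b ≤ L → (q j + m ≤ b ∨ b + m ≤ q j) →
      m ≤ G.dist x (f b) + K := by
    intro j x hx b m hb h
    have h1 := hff (q j) b m (by have := hqL j; omega) hb h
    have h2 := (hTr j x hx).dist_triangle_left (f b)
    have h3 := hTq j x hx
    rw [SimpleGraph.dist_comm] at h3
    omega
  have hTT : ∀ i j, i < j → ∀ x ∈ T i, ∀ y ∈ T j, K ≤ G.dist x y := by
    intro i j hij x hx y hy
    have h0 := hq i j hij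
    have h1 := hTf i x hx (q j) (8 * K) (by have := hqL j; omega) (by omega)
    have h2 := (hTr j y hy).symm.dist_triangle_right x
    have h3 := hTq j y hy
    omega
  have hqq : ∀ i j : Fin t, (i : ℕ) ≤ j → q i ≤ q j := by
    intro i j h
    rcases h.eq_or_lt with h | h
    · rw [Fin.ext h]
    · have := hq i j h; omega
  have far : ∀ X Y : Set V, (∀ x ∈ X, ∀ y ∈ Y, K ≤ G.dist x y) →
      SubgraphDistGE G K (inducedOn G X) (inducedOn G Y) :=
    fun X Y h x hx y hy => natCast_le_edist_of fun _ => h x hx y hy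
  have hBB : ∀ i j, i < j → SubgraphDistGE G K (inducedOn G (B i)) (inducedOn G (B j)) := by
    intro i j hij
    refine far _ _ ?_
    rintro _ ⟨a, ⟨ha, ha'⟩, rfl⟩ _ ⟨b, ⟨hb, hb'⟩, rfl⟩
    have := hq i j hij
    have := hqL i
    have := hqL j
    exact hff a b K (by omega) (by omega) (by omega)
  refine ⟨{
    branchSet := fun w => w.elim (inducedOn G H) fun j => inducedOn G (B j)
    branchPath := fun e => inducedOn G (S e)
    branchSet_connected := ?_
    branchPath_connected := ?_
    incident := ?_
    far_sets := ?_
    far_paths := ?_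
    far_set_path := ?_ }⟩
  · rintro (_ | j)
    · exact inducedOn_connected hH
    · exact inducedOn_connected (hf.induce_image_Icc_connected (by omega) (hqL j))
  · intro e
    refine inducedOn_connected ?_
    rcases hS e with ⟨j, -, h⟩ | ⟨i, j, hij, -, h⟩
    · rw [h]; exact hT j
    · rw [h]
      have := hq i j (by rw [Fin.lt_def]; omega)
      have := hqL j
      exact hf.induce_image_Icc_connected (by omega) (by omega)
  · intro w e hw
    rcases hS e with ⟨j, he, h⟩ | ⟨i, j, hij, he, h⟩
    · rw [he, Sym2.mem_iff] at hw
      rcases hw with rfl | rfl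
      · simpa [h] using hTH j
      · refine ⟨f (q j), ?_, ?_⟩
        · exact ⟨q j, ⟨by omega, by omega⟩, rfl⟩
        · simpa [h] using hqT j
    · have := hq i j (by rw [Fin.lt_def]; omega)
      rw [he, Sym2.mem_iff] at hw
      rcases hw with rfl | rfl
      · refine ⟨f (q i + 2 * K), ⟨_, ⟨by omega, by omega⟩, rfl⟩, ?_⟩
        simp only [inducedOn, SimpleGraph.Subgraph.induce_verts, h]
        exact ⟨_, ⟨by omega, by omega⟩, rfl⟩
      · refine ⟨f (q j - 2 * K), ⟨_, ⟨by omega, by omega⟩, rfl⟩, ?_⟩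
        simp only [inducedOn, SimpleGraph.Subgraph.induce_verts, h]
        exact ⟨_, ⟨by omega, by omega⟩, rfl⟩
  · have hHB : ∀ j, SubgraphDistGE G K (inducedOn G H) (inducedOn G (B j)) := by
      intro j
      refine far _ _ ?_
      rintro x hx _ ⟨a, ⟨ha, ha'⟩, rfl⟩
      exact hHf x hx a (by have := hqL j; omega)
    rintro (_ | i) (_ | j) hij
    · exact absurd rfl hij
    · exact hHB j
    · exact subgraphDistGE_comm (hHB i)
    · rcases lt_trichotomy i j with h | h | h
      · exact hBB i j h
      · exact absurd (by rw [h]) hij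
      · exact subgraphDistGE_comm (hBB j i h)
  · have hTe : ∀ k i j : Fin t, (i : ℕ) + 1 = j → SubgraphDistGE G K (inducedOn G (T k))
        (inducedOn G (f '' Set.Icc (q i + 2 * K) (q j - 2 * K))) := by
      intro k i j hij
      refine far _ _ ?_
      rintro x hx _ ⟨a, ⟨ha, ha'⟩, rfl⟩
      have := hq i j (by rw [Fin.lt_def]; omega)
      have := hqL j
      have : K + K ≤ G.dist x (f a) + K := by
        -- The tight case: 2K along f, minus the K lost on the connector.
        refine hTf k x hx a (K + K) (by omega) ?_
        rcases le_or_gt (k : ℕ) i with h | h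
        · have := hqq k i h; omega
        · have := hqq j k (by omega); omega
      omega
    have hee : ∀ i j i' j' : Fin t, (i : ℕ) + 1 = j → (i' : ℕ) + 1 = j' → i < i' →
        SubgraphDistGE G K (inducedOn G (f '' Set.Icc (q i + 2 * K) (q j - 2 * K)))
          (inducedOn G (f '' Set.Icc (q i' + 2 * K) (q j' - 2 * K))) := by
      intro i j i' j' hij hij' hlt
      refine far _ _ ?_
      rintro _ ⟨a, ⟨ha, ha'⟩, rfl⟩ _ ⟨b, ⟨hb, hb'⟩, rfl⟩
      have := hq i j (by rw [Fin.lt_def]; omega)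
      have := hqq j i' (by rw [Fin.lt_def] at hlt; omega)
      have := hqL j
      have := hqL j'
      exact hff a b K (by omega) (by omega) (by omega)
    intro e e' hne
    rcases hS e with ⟨j, he, h⟩ | ⟨i, j, hij, he, h⟩ <;>
      rcases hS e' with ⟨j', he', h'⟩ | ⟨i', j', hij', he', h'⟩ <;> simp only [h, h']
    · have hjj : j ≠ j' := by
        rintro rfl
        exact hne (Subtype.ext (he.trans he'.symm))
      rcases lt_or_gt_of_ne hjj with hlt | hlt
      · exact far _ _ (hTT _ _ hlt)
      · exact subgraphDistGE_comm (far _ _ (hTT _ _ hlt))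
    · exact hTe j i' j' hij'
    · exact subgraphDistGE_comm (hTe j' i j hij)
    · have hii : i ≠ i' := by
        rintro rfl
        have : j = j' := Fin.ext (by omega)
        subst this
        exact hne (Subtype.ext (he.trans he'.symm))
      rcases lt_or_gt_of_ne hii with hlt | hlt
      · exact hee _ _ _ _ hij hij' hlt
      · exact subgraphDistGE_comm (hee _ _ _ _ hij' hij hlt)
  · rintro (_ | k) e hw <;> rcases hS e with ⟨j, he, h⟩ | ⟨i, j, hij, he, h⟩ <;>
      rw [he] at hw <;> simp only [h, Option.elim]
    · simp at hw
    · refine far _ _ ?_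
      rintro x hx _ ⟨a, ⟨ha, ha'⟩, rfl⟩
      exact hHf x hx a (by have := hqL j; omega)
    · have hkj : k ≠ j := by simpa using hw
      refine subgraphDistGE_comm (far _ _ ?_)
      rintro x hx _ ⟨a, ⟨ha, ha'⟩, rfl⟩
      have h2 := hqL k
      have : 6 * K ≤ G.dist x (f a) + K := by
        refine hTf j x hx a (6 * K) (by omega) ?_
        rcases lt_or_gt_of_ne hkj with hlt | hlt
        · have := hq _ _ hlt; omega
        · have := hq _ _ hlt; omega
      omega
    · have hk : k ≠ i ∧ k ≠ j := by simpa using hw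
      refine far _ _ ?_
      rintro _ ⟨b, ⟨hb, hb'⟩, rfl⟩ _ ⟨a, ⟨ha, ha'⟩, rfl⟩
      have h2 := hqL k
      have h3 := hqL j
      have h4 := hq i j (by rw [Fin.lt_def]; omega)
      refine hff b a K (by omega) (by omega) ?_
      rcases lt_or_gt_of_ne hk.1 with hlt | hlt
      · have := hq _ _ hlt; omega
      · have hjk : j < k := lt_of_le_of_ne (by rw [Fin.le_def]; rw [Fin.lt_def] at hlt; omega)
          hk.2.symm
        have := hq _ _ hjk; omega

/-- The geodesic from a vertex of the geodesic `f` to a vertex `r` far from `f` contains a hub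
around `r`, linked to `f` by a short connector. -/
theorem IsGeodesicSeq.exists_hub {f : ℕ → V} {L K : ℕ} (hf : IsGeodesicSeq G f L) {r : V}
    (hr : G.Reachable r (f 0)) (hK : ∀ i ≤ L, K < G.dist r (f i)) {p : ℕ} (hp : p ≤ L) :
    ∃ q ≤ L, ∃ H T : Set V, (G.induce H).Connected ∧ (G.induce T).Connected ∧ r ∈ H ∧
      (∀ x ∈ H, ∀ i ≤ L, K ≤ G.dist x (f i)) ∧ (H ∩ T).Nonempty ∧ f q ∈ T ∧
      (∀ x ∈ T, G.dist x (f q) ≤ K) ∧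
      ∃ x, G.Reachable r x ∧ G.dist r x + G.dist x (f p) = G.dist r (f p) ∧
        G.dist x (f q) ≤ K := by
  classical
  have hrf : ∀ i ≤ L, G.Reachable r (f i) := fun i hi => hr.trans (hf.reachable (Nat.zero_le i) hi)
  obtain ⟨g, hg, hg0, hgl⟩ := (hrf p hp).symm.exists_isGeodesicSeq
  set l := G.dist (f p) r with hl
  have hrg : ∀ i ≤ l, G.Reachable r (g i) := fun i hi => by
    have := (hg.reachable hi le_rfl).symm
    rwa [hgl] at this
  set P : ℕ → Prop := fun s => ∃ q ≤ L, G.dist (g s) (f q) ≤ K with hP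
  -- g runs from `f p` to r, so s is the last moment at which it is within K of f. The rest of g
  -- becomes the hub, and a geodesic from `g s` to f the connector.
  set s := Nat.findGreatest P l with hs
  have hP0 : P 0 := ⟨p, hp, by rw [hg0]; simp⟩
  have hPs : P s := Nat.findGreatest_spec (P := P) (Nat.zero_le l) hP0
  have hsl : s ≤ l := Nat.findGreatest_le l
  have hfar : ∀ k, s < k → k ≤ l → ∀ i ≤ L, K < G.dist (g k) (f i) := by
    intro k hk hkl i hi
    by_contra! h
    exact Nat.findGreatest_is_greatest hk hkl ⟨i, hi, h⟩
  have hsl' : s < l := by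
    rcases hsl.lt_or_eq with h | h
    · exact h
    · obtain ⟨q, hq, hq'⟩ := hPs
      rw [h, hgl] at hq'
      exact absurd (hK q hq) (by omega)
  obtain ⟨q, hq, hsq⟩ := hPs
  have hrs : G.Reachable (g s) (f q) := (hrg s hsl).symm.trans (hrf q hq)
  obtain ⟨h, hh, hh0, hhm⟩ := hrs.exists_isGeodesicSeq
  refine ⟨q, hq, g '' Set.Icc s l, h '' Set.Icc 0 (G.dist (g s) (f q)),
    hg.induce_image_Icc_connected hsl le_rfl, hh.induce_image_Icc_connected (Nat.zero_le _) le_rfl,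
    ⟨l, ⟨hsl, le_rfl⟩, hgl⟩, ?_, ⟨g s, ⟨s, ⟨le_rfl, hsl⟩, rfl⟩, 0, by simp, hh0⟩,
    ⟨_, ⟨Nat.zero_le _, le_rfl⟩, hhm⟩, ?_, g s, hrg s hsl, ?_, hsq⟩
  · rintro _ ⟨k, ⟨hk, hkl⟩, rfl⟩ i hi
    rcases hk.lt_or_eq with hk | rfl
    · exact (hfar k hk hkl i hi).le
    · have h1 := hfar (s + 1) (by omega) (by omega) i hi
      have h2 := (hg.adj s hsl').symm.reachable.dist_triangle_left (f i)
      have h3 := SimpleGraph.dist_eq_one_iff_adj.mpr (hg.adj s hsl').symm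
      omega
  · rintro _ ⟨k, ⟨-, hk⟩, rfl⟩
    have := hh.dist_eq k _ hk le_rfl
    rw [hhm] at this
    omega
  · have h1 := hg.dist_eq 0 s (Nat.zero_le _) hsl
    have h2 := hg.dist_eq s l hsl le_rfl
    rw [hg0] at h1
    rw [hgl] at h2
    rw [SimpleGraph.dist_comm (u := r), h2, SimpleGraph.dist_comm, h1,
      SimpleGraph.dist_comm (u := r), ← hl]
    omega

/-- A long antichain (with respect to the distances from `r`) on a geodesic yields a fat minor. -/
theorem isFatMinor_uGraph_of_antichain {f : ℕ → V} {L K t : ℕ} (ht : 1 ≤ t)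
    (hf : IsGeodesicSeq G f L) {r : V} (hr : G.Reachable r (f 0)) (a : ℕ → ℕ)
    (ha : ∀ i ≤ (2 * K + 1) * (8 * t + 2), a i ≤ L)
    (h₁ : ∀ i < (2 * K + 1) * (8 * t + 2),
      a i + G.dist r (f (a i)) < a (i + 1) + G.dist r (f (a (i + 1))))
    (h₂ : ∀ i < (2 * K + 1) * (8 * t + 2),
      a i + G.dist r (f (a (i + 1))) < a (i + 1) + G.dist r (f (a i))) :
    IsFatMinor (uGraph t) K G := by
  have hrf : ∀ i ≤ L, G.Reachable r (f i) := fun i hi => hr.trans (hf.reachable (Nat.zero_le i) hi)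
  -- A detour via a point within K of f changes lengths by at most 2K; g steps along the antichain
  -- gain more than that.
  obtain ⟨g, hg⟩ : ∃ g, g = 2 * K + 1 := ⟨_, rfl⟩
  obtain ⟨N, hN⟩ : ∃ N, N = (2 * K + 1) * (8 * t + 2) := ⟨_, rfl⟩
  rw [← hN] at ha h₁ h₂
  have mono₁ : ∀ i j, i ≤ j → j ≤ N →
      a i + G.dist r (f (a i)) + (j - i) ≤ a j + G.dist r (f (a j)) := by
    intro i j hij
    induction j, hij using Nat.le_induction with
    | base => intro _; omega
    | succ j hij ih => intro hj; have := ih (by omega); have := h₁ j (by omega); omega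
  -- The monotonicity of position minus distance from r, written without subtraction.
  have mono₂ : ∀ i j, i ≤ j → j ≤ N →
      a i + G.dist r (f (a j)) + (j - i) ≤ a j + G.dist r (f (a i)) := by
    intro i j hij
    induction j, hij using Nat.le_induction with
    | base => intro _; omega
    | succ j hij ih => intro hj; have := ih (by omega); have := h₂ j (by omega); omega
  have mono : ∀ i j, i ≤ j → j ≤ N → a i + (j - i) ≤ a j := fun i j hij hj => by
    have := mono₁ i j hij hj
    have := mono₂ i j hij hj
    omega
  -- Localization: x lies on a shortest path from r to `f (a c)` and is within K of `f q`. If q were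
  -- outside the window, going from r to `f q` and then along f to `f (a c)` would exceed the
  -- shortest length by at most 2K, although it passes `f (a (c - g))` or `f (a (c + g))`, where the
  -- excess is at least g.
  have loc : ∀ c x q, g ≤ c → c + g ≤ N → G.Reachable r x →
      G.dist r x + G.dist x (f (a c)) = G.dist r (f (a c)) → q ≤ L → G.dist x (f q) ≤ K →
      a (c - g) < q ∧ q < a (c + g) := by
    intro c x q hgc hcN hx hxc hq hxq
    have haL := ha c (by omega)
    have d1 := hx.symm.dist_triangle_right (f q)
    have d2 := hx.dist_triangle_left (f q)
    have d3 := ((hrf q hq).symm.trans hx).dist_triangle_left (f (a c))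
    rw [SimpleGraph.dist_comm (u := f q) (v := x)] at d3
    constructor
    · by_contra! hle
      have hm := mono (c - g) c (by omega) (by omega)
      have e1 := hf.dist_eq q (a c) (by omega) haL
      have e2 := hf.dist_eq q (a (c - g)) hle (by omega)
      have e3 := (hrf q hq).dist_triangle_left (f (a (c - g)))
      have e4 := mono₂ (c - g) c (by omega) (by omega)
      omega
    · by_contra! hle
      have hm := mono c (c + g) (by omega) (by omega)
      have e1 := hf.dist_eq (a c) q (by omega) hq
      have e2 := hf.dist_eq (a (c + g)) q hle hq
      have e3 := (hrf q hq).dist_triangle_left (f (a (c + g)))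
      rw [SimpleGraph.dist_comm (u := f q), e2] at e3
      rw [SimpleGraph.dist_comm (u := f q), e1] at d3
      have e4 := mono₁ c (c + g) (by omega) (by omega)
      omega
  -- The anchors are the indices `g * (8 * j + 1)`. Their windows of radius g have gaps of 6g, which
  -- exceeds 8K. The first window starts at index 0, and the unused anchor with j = t leaves room at
  -- the end of f.
  have hcN : ∀ j ≤ t, g * (8 * j + 1) + g ≤ N := fun j hj => by
    have : g * (8 * j + 2) ≤ g * (8 * t + 2) := Nat.mul_le_mul_left _ (by omega)
    rw [hN, ← hg]
    calc g * (8 * j + 1) + g = g * (8 * j + 2) := by ring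
      _ ≤ _ := this
  have hgc : ∀ j, g ≤ g * (8 * j + 1) := fun j => Nat.le_mul_of_pos_right _ (by omega)
  have hcc : ∀ i j, i < j → g * (8 * i + 1) + 8 * g ≤ g * (8 * j + 1) := fun i j hij => by
    calc g * (8 * i + 1) + 8 * g = g * (8 * (i + 1) + 1) := by ring
      _ ≤ _ := Nat.mul_le_mul_left _ (by omega)
  -- The root lies on every shortest path from it, so if it were within K of `f q`, then q would be
  -- in the windows of two different anchors.
  have hrK : ∀ i ≤ L, K < G.dist r (f i) := by
    intro q hq
    by_contra! h
    have l0 := loc (g * (8 * 0 + 1)) r q (hgc 0) (hcN 0 (by omega)) SimpleGraph.Reachable.rfl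
      (by simp) hq h
    have l1 := loc (g * (8 * 1 + 1)) r q (hgc 1) (hcN 1 (by omega)) SimpleGraph.Reachable.rfl
      (by simp) hq h
    have := hcc 0 1 (by omega)
    have := hcN 1 ht
    have := mono (g * (8 * 0 + 1) + g) (g * (8 * 1 + 1) - g) (by omega) (by omega)
    omega
  have key : ∀ j : Fin t, ∃ q ≤ L, ∃ H T : Set V, (G.induce H).Connected ∧
      (G.induce T).Connected ∧ r ∈ H ∧ (∀ x ∈ H, ∀ i ≤ L, K ≤ G.dist x (f i)) ∧
      (H ∩ T).Nonempty ∧ f q ∈ T ∧ (∀ x ∈ T, G.dist x (f q) ≤ K) ∧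
      a (g * (8 * (j : ℕ) + 1) - g) < q ∧ q < a (g * (8 * (j : ℕ) + 1) + g) := by
    intro j
    have hcj := hcN j j.2.le
    obtain ⟨q, hq, H, T, hH, hT, h1, h2, h3, h4, h5, x, hx, hx1, hx2⟩ :=
      hf.exists_hub hr hrK (ha (g * (8 * (j : ℕ) + 1)) (by omega))
    exact ⟨q, hq, H, T, hH, hT, h1, h2, h3, h4, h5, loc _ x q (hgc j) hcj hx hx1 hq hx2⟩
  choose q hqL H T hH hT hrH hHf hHT hqT hTq hqa hqa' using key
  refine isFatMinor_uGraph_of_hub hf q ?_ ?_ (⋃ j, H j) ?_ ?_ T hT ?_ hqT hTq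
  · intro j
    have h1 := hcc j t j.2
    have h2 := hcN t le_rfl
    have h3 := mono (g * (8 * (j : ℕ) + 1) + g) N (by omega) le_rfl
    have h4 := ha N le_rfl
    have h5 := hqa' j
    omega
  · intro i j hij
    have h1 := hcc i j hij
    have h2 := hcN j j.2.le
    have h3 := mono (g * (8 * (i : ℕ) + 1) + g) (g * (8 * (j : ℕ) + 1) - g) (by omega) (by omega)
    have h4 := hqa j
    have h5 := hqa' i
    omega
  -- All partial hubs contain r, so their union is connected.
  · refine G.induce_connected_of_patches r (Set.mem_iUnion.mpr ⟨⟨0, ht⟩, hrH _⟩) ?_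
    intro v hv
    obtain ⟨j, hj⟩ := Set.mem_iUnion.mp hv
    exact ⟨H j, Set.subset_iUnion H j, hrH j, hj, (hH j).preconnected _ _⟩
  · intro x hx
    obtain ⟨j, hj⟩ := Set.mem_iUnion.mp hx
    exact hHf j x hj
  · intro j
    obtain ⟨x, hx, hx'⟩ := hHT j
    exact ⟨x, Set.mem_iUnion.mpr ⟨j, hx⟩, hx'⟩

end Geodesic

/-! ### The order of shortest paths from the roots, and the lower bound from antichains -/

section RootOrder

variable {V : Type*}

/-- `x` precedes `y` in the order of the shortest paths from the root of their component. -/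
def RootLT (G : SimpleGraph V) (root : V → V) (x y : V) : Prop :=
  x ≠ y ∧ G.Reachable x y ∧ G.dist (root y) y = G.dist (root x) x + G.dist x y

/-- `root` chooses a vertex in each component. -/
structure IsRootMap (G : SimpleGraph V) (root : V → V) : Prop where
  reachable : ∀ x, G.Reachable (root x) x
  eq_of_reachable : ∀ x y, G.Reachable x y → root x = root y

/-- One more element of A on the path would give enough indices for
`isFatMinor_uGraph_of_antichain`, applied to the positions of these elements on the path in
increasing order. -/
theorem card_filter_mem_isometricPath_le {G : SimpleGraph V} {root : V → V}
    (hroot : IsRootMap G root) {t K : ℕ} (ht : 1 ≤ t) (hG : ¬ IsFatMinor (uGraph t) K G)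
    (A : Finset V) (hA : ∀ x ∈ A, ∀ y ∈ A, ¬ RootLT G root x y) [DecidableEq V] (l : List V)
    (hl : IsIsometricPath G l) :
    (A.filter (· ∈ l)).card ≤ (2 * K + 1) * (8 * t + 2) := by
  obtain ⟨u, v, p, -, hp, rfl⟩ := hl
  by_contra! hcard
  apply hG
  have hf := p.isGeodesicSeq hp
  set f := p.getVert with hfdef
  set L := p.length with hL
  set N := (2 * K + 1) * (8 * t + 2) with hN
  set S := (Finset.range (L + 1)).filter (fun q => f q ∈ A) with hS
  have hNS : N < S.card := by
    refine hcard.trans_le ((Finset.card_le_card ?_).trans (Finset.card_image_le (s := S) (f := f)))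
    intro x hx
    rw [Finset.mem_filter, SimpleGraph.Walk.mem_support_iff_exists_getVert] at hx
    obtain ⟨hxA, q, rfl, hq⟩ := hx
    exact Finset.mem_image.mpr ⟨q, by simp [hS, hfdef, hxA]; omega, rfl⟩
  set e := S.orderEmbOfFin rfl with he
  set a : ℕ → ℕ := fun i => if h : i < S.card then e ⟨i, h⟩ else 0 with ha
  have haS : ∀ i ≤ N, a i ∈ S := fun i hi => by
    simp only [ha, dif_pos (hi.trans_lt hNS)]
    exact Finset.orderEmbOfFin_mem _ _ _
  have haL : ∀ i ≤ N, a i ≤ L := fun i hi => by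
    have := haS i hi
    simp [hS] at this
    omega
  have haA : ∀ i ≤ N, f (a i) ∈ A := fun i hi => by
    have := haS i hi
    simp only [hS, Finset.mem_filter] at this
    exact this.2
  have hmono : ∀ i < N, a i < a (i + 1) := fun i hi => by
    simp only [ha, dif_pos (show i < S.card by omega), dif_pos (show i + 1 < S.card by omega)]
    exact e.strictMono (by simp)
  have hroot' : ∀ q ≤ L, root (f q) = root (f 0) := fun q hq =>
    (hroot.eq_of_reachable _ _ (hf.reachable (Nat.zero_le q) hq)).symm
  have hr : G.Reachable (root (f 0)) (f 0) := hroot.reachable _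
  -- The inequalities are the triangle inequality. Equality in either of them would make one of the
  -- two vertices precede the other, against the antichain property.
  have step : ∀ i < N, G.dist (root (f 0)) (f (a (i + 1))) ≠
        G.dist (root (f 0)) (f (a i)) + (a (i + 1) - a i) ∧
      G.dist (root (f 0)) (f (a i)) ≠
        G.dist (root (f 0)) (f (a (i + 1))) + (a (i + 1) - a i) ∧
      G.dist (root (f 0)) (f (a (i + 1))) ≤
        G.dist (root (f 0)) (f (a i)) + (a (i + 1) - a i) ∧
      G.dist (root (f 0)) (f (a i)) ≤
        G.dist (root (f 0)) (f (a (i + 1))) + (a (i + 1) - a i) := by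
    intro i hi
    have hlt := hmono i hi
    have h1 := haL i hi.le
    have h2 := haL (i + 1) hi
    have hd := hf.dist_eq (a i) (a (i + 1)) hlt.le h2
    have hd' := hd
    rw [SimpleGraph.dist_comm] at hd'
    have hre := hf.reachable hlt.le h2
    have hne : f (a i) ≠ f (a (i + 1)) := by
      intro h
      rw [h, SimpleGraph.dist_self] at hd
      omega
    have t1 := hre.dist_triangle_right (root (f 0))
    have t2 := hre.symm.dist_triangle_right (root (f 0))
    refine ⟨fun h => hA _ (haA i hi.le) _ (haA (i + 1) hi) ⟨hne, hre, ?_⟩,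
      fun h => hA _ (haA (i + 1) hi) _ (haA i hi.le) ⟨hne.symm, hre.symm, ?_⟩, by omega, by omega⟩
    · rw [hroot' _ h1, hroot' _ h2, hd, h]
    · rw [hroot' _ h1, hroot' _ h2, hd', h]
  refine isFatMinor_uGraph_of_antichain ht hf hr a haL ?_ ?_
  · intro i hi
    have := step i hi
    have := hmono i hi
    omega
  · intro i hi
    have := step i hi
    have := hmono i hi
    omega

/-- Every element of A lies on some path of the cover, and each path accounts for a bounded number
of them. -/
theorem card_antichain_le_mul_length {G : SimpleGraph V} {root : V → V}
    (hroot : IsRootMap G root) {t K : ℕ} (ht : 1 ≤ t) (hG : ¬ IsFatMinor (uGraph t) K G)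
    (A : Finset V) (hA : ∀ x ∈ A, ∀ y ∈ A, ¬ RootLT G root x y) (Q : List (List V))
    (hQ : IsIsometricPathCover G Q) :
    A.card ≤ (2 * K + 1) * (8 * t + 2) * Q.length := by
  classical
  have key : ∀ Q : List (List V), (∀ l ∈ Q, IsIsometricPath G l) →
      (A.filter (fun v => ∃ l ∈ Q, v ∈ l)).card ≤ (2 * K + 1) * (8 * t + 2) * Q.length := by
    intro Q
    induction Q with
    | nil => simp
    | cons l Q ih =>
      intro h
      have h1 := ih fun l' hl' => h l' (List.mem_cons_of_mem _ hl')
      have h2 := card_filter_mem_isometricPath_le hroot ht hG A hA l (h l List.mem_cons_self)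
      have : A.filter (fun v => ∃ l' ∈ l :: Q, v ∈ l') =
          A.filter (· ∈ l) ∪ A.filter (fun v => ∃ l ∈ Q, v ∈ l) := by
        ext v
        simp [← and_or_left]
      rw [this, List.length_cons, mul_add, mul_one, add_comm]
      exact (Finset.card_union_le _ _).trans (Nat.add_le_add h2 h1)
  have := key Q hQ.1
  rwa [Finset.filter_true_of_mem fun v _ => hQ.2 v] at this

end RootOrder

/-! ### The auction for bipartite matching and its duality certificate -/

section Auction

variable {V : Type*} [Fintype V]

/-- The state of an auction which matches left vertices `x` with right vertices `y` along the
edges `E x y`: prices of the right vertices, their partners, the current bidder, and the set of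
left vertices that have entered the auction. -/
structure AuctionInv (E : V → V → Prop) (price : V → ℕ) (partner : V → Option V)
    (cur : Option V) (D : Set V) : Prop where
  edge : ∀ x y, partner y = some x → E x y
  inj : ∀ x y y', partner y = some x → partner y' = some x → y = y'
  slack : ∀ x y y', partner y = some x → E x y' → price y ≤ price y' + 1
  zero : ∀ y, partner y = none → price y = 0
  le_card : ∀ y, price y ≤ Fintype.card V
  partner_mem : ∀ x y, partner y = some x → x ∈ D
  partner_ne : ∀ x y, partner y = some x → cur ≠ some x
  cur_mem : ∀ x, cur = some x → x ∈ D
  settled : ∀ x ∈ D, cur ≠ some x →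
    (∃ y, partner y = some x) ∨ ∀ y, E x y → Fintype.card V ≤ price y

namespace AuctionInv

variable {E : V → V → Prop} {price : V → ℕ} {partner : V → Option V} {D : Set V}

theorem init : AuctionInv E (fun _ => 0) (fun _ => none) none ∅ := by
  constructor <;> simp

theorem start (h : AuctionInv E price partner none D) {x : V} (hx : x ∉ D) :
    AuctionInv E price partner (some x) (insert x D) where
  edge := h.edge
  inj := h.inj
  slack := h.slack
  zero := h.zero
  le_card := h.le_card
  partner_mem z y hz := Or.inr (h.partner_mem z y hz)
  partner_ne z y hz := by
    rintro ⟨⟩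
    exact hx (h.partner_mem _ y hz)
  cur_mem := by
    rintro z ⟨⟩
    exact Or.inl rfl
  settled z hz hne := by
    rcases hz with rfl | hz
    · exact absurd rfl hne
    · exact h.settled z hz (by simp)

theorem withdraw {x : V} (h : AuctionInv E price partner (some x) D)
    (hx : ∀ y, E x y → Fintype.card V ≤ price y) : AuctionInv E price partner none D where
  edge := h.edge
  inj := h.inj
  slack := h.slack
  zero := h.zero
  le_card := h.le_card
  partner_mem := h.partner_mem
  partner_ne := by simp
  cur_mem := by simp
  settled z hz _ := by
    by_cases hzx : z = x
    · exact Or.inr (hzx ▸ hx)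
    · exact h.settled z hz (by simpa using fun h => hzx h.symm)

/-- The previous partner of y becomes the next bidder; if there was none, the round is over. `slack`
holds for x because y was a cheapest choice before its price rose by one, and it survives for the
others because the prices of their own partners stay fixed and no price falls. -/
theorem bid [DecidableEq V] {x y : V} (h : AuctionInv E price partner (some x) D) (hxy : E x y)
    (hy : price y < Fintype.card V) (hmin : ∀ y', E x y' → price y ≤ price y') :
    AuctionInv E (Function.update price y (price y + 1)) (Function.update partner y (some x))
      (partner y) D := by
  have hpr : ∀ z, price z ≤ Function.update price y (price y + 1) z := fun z => by
    rw [Function.update_apply]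
    split_ifs with hz
    · rw [hz]; omega
    · rfl
  have hne : ∀ y', partner y' ≠ some x := fun y' hy' => h.partner_ne x y' hy' rfl
  refine ⟨?_, ?_, ?_, ?_, ?_, ?_, ?_, ?_, ?_⟩
  · intro z y' hz
    rw [Function.update_apply] at hz
    split_ifs at hz with hy'
    · cases hz; rwa [hy']
    · exact h.edge z y' hz
  · intro z y₁ y₂ h₁ h₂
    rw [Function.update_apply] at h₁ h₂
    split_ifs at h₁ h₂ with e₁ e₂ e₂
    · rw [e₁, e₂]
    · cases h₁; exact absurd h₂ (hne _)
    · cases h₂; exact absurd h₁ (hne _)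
    · exact h.inj z _ _ h₁ h₂
  · intro z y₁ y₂ h₁ h₂
    refine le_trans ?_ (Nat.add_le_add_right (hpr y₂) 1)
    rw [Function.update_apply] at h₁ ⊢
    split_ifs at h₁ ⊢ with e₁
    · cases h₁
      have := hmin y₂ h₂
      omega
    · exact h.slack z _ _ h₁ h₂
  · intro y' hy'
    rw [Function.update_apply] at hy' ⊢
    split_ifs at hy' ⊢
    exact h.zero y' hy'
  · intro y'
    rw [Function.update_apply]
    split_ifs
    · omega
    · exact h.le_card y'
  · intro z y' hz
    rw [Function.update_apply] at hz
    split_ifs at hz with e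
    · cases hz; exact h.cur_mem _ rfl
    · exact h.partner_mem z y' hz
  · intro z y' hz hz'
    rw [Function.update_apply] at hz
    split_ifs at hz with e
    · cases hz; exact hne _ hz'
    · exact e (h.inj z _ _ hz hz')
  · exact fun z hz => h.partner_mem z y hz
  · intro z hz hzy
    by_cases hzx : z = x
    · exact Or.inl ⟨y, by simp [hzx]⟩
    · rcases h.settled z hz (by simpa using fun h => hzx h.symm) with ⟨y', hy'⟩ | hz'
      · refine Or.inl ⟨y', ?_⟩
        rw [Function.update_of_ne, hy']
        rintro rfl
        exact hzy hy'
      · exact Or.inr fun y' hy' => (hz' y' hy').trans (hpr y')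

/-- At the end of the auction, a gap in the prices separates off an antichain with at least as
many elements as there are unmatched left vertices. -/
theorem exists_antichain (h : AuctionInv E price partner none Set.univ) :
    ∃ A : Finset V, (∀ x ∈ A, ∀ y ∈ A, ¬ E x y) ∧
      ∀ F : Finset V, (∀ x ∈ F, ∀ y, partner y ≠ some x) → F.card ≤ A.card := by
  classical
  -- Pigeonhole: the prices of n vertices miss one of the n + 1 values from 0 to n.
  obtain ⟨g, hgn, hg⟩ : ∃ g ≤ Fintype.card V, ∀ y, price y ≠ g := by
    by_contra! hcon
    have : Finset.range (Fintype.card V + 1) ⊆ Finset.univ.image price := fun g hg => by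
      obtain ⟨y, hy⟩ := hcon g (by simpa [Nat.lt_succ_iff] using hg)
      exact Finset.mem_image.mpr ⟨y, Finset.mem_univ y, hy⟩
    have := (Finset.card_le_card this).trans Finset.card_image_le
    simp at this
  set S : Finset V := Finset.univ.filter fun y => g < price y with hS
  -- All edges out of F ∪ M end in S. A free vertex sees only prices at least n, hence at least g. A
  -- vertex of M sees only prices at least g, by `slack`. The value g itself does not occur.
  -- Removing S therefore leaves an antichain, and it costs no more than adding M gained, since
  -- every vertex of positive price is matched.
  set M : Finset V := Finset.univ.filter fun x => ∃ y, partner y = some x ∧ g < price y with hM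
  set F : Finset V := Finset.univ.filter fun x => ∀ y, partner y ≠ some x with hF
  have hSM : S.card ≤ M.card := by
    refine Finset.card_le_card_of_injOn (fun y => (partner y).getD y) ?_ ?_
    · intro y hy
      simp only [hS, Finset.coe_filter, Finset.mem_univ, true_and, Set.mem_ofPred_eq] at hy
      obtain ⟨x, hx⟩ : ∃ x, partner y = some x := Option.ne_none_iff_exists'.mp fun hn => by
        have := h.zero y hn; omega
      simp only [hM, Finset.coe_filter, Finset.mem_univ, true_and, Set.mem_ofPred_eq, hx,
        Option.getD_some]
      exact ⟨y, hx, hy⟩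
    · intro y hy y' hy' heq
      simp only [hS, Finset.coe_filter, Finset.mem_univ, true_and, Set.mem_ofPred_eq] at hy hy'
      obtain ⟨x, hx⟩ : ∃ x, partner y = some x := Option.ne_none_iff_exists'.mp fun hn => by
        have := h.zero y hn; omega
      obtain ⟨x', hx'⟩ : ∃ x, partner y' = some x := Option.ne_none_iff_exists'.mp fun hn => by
        have := h.zero y' hn; omega
      simp only [hx, hx', Option.getD_some] at heq
      subst heq
      exact h.inj _ _ _ hx hx'
  have hFM : Disjoint F M := by
    rw [Finset.disjoint_left]
    intro x hx hx'
    simp only [hF, hM, Finset.mem_filter, Finset.mem_univ, true_and] at hx hx'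
    obtain ⟨y, hy, -⟩ := hx'
    exact hx y hy
  refine ⟨(F ∪ M) \ S, ?_, ?_⟩
  · intro x hx y hy hxy
    simp only [hF, hM, hS, Finset.mem_sdiff, Finset.mem_union, Finset.mem_filter,
      Finset.mem_univ, true_and] at hx hy
    have hgy := hg y
    rcases hx.1 with hx | ⟨y', hy', hgy'⟩
    · rcases h.settled x trivial (by simp) with ⟨y', hy'⟩ | h'
      · exact hx y' hy'
      · have := h' y hxy; omega
    · have := h.slack x y' y hy' hxy; omega
  · intro F' hF'
    have h1 : F'.card ≤ F.card := Finset.card_le_card fun x hx => by simpa [hF] using hF' x hx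
    have h2 := Finset.card_union_of_disjoint hFM
    have h3 := Finset.le_card_sdiff S (F ∪ M)
    omega

end AuctionInv

end Auction

/-! ### A language of bounded loops, and its compilation to random access machines -/

namespace RAM

theorem Exec.loop_exit {c : Cond} {p : Program} {s : State} (hc : ¬ c.Holds s) :
    Exec (.loop c p) s 1 s := by
  constructor
  exact hc

/-- Expressions; register `0` holds the size of the input. -/
inductive Expr where
  | lit (c : ℕ)
  | var (x : ℕ)
  | add (a b : Expr)
  | mulSize (a : Expr)
  | load (k : ℕ) (a : Expr)

/-- The value of an expression. -/
def Expr.eval : Expr → State → ℕ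
  | lit c, _ => c
  | var x, s => s.reg x
  | add a b, s => a.eval s + b.eval s
  | mulSize a, s => a.eval s * s.reg 0
  | load k a, s => s.arr k (a.eval s)

/-- Code in which all loops run over the numbers below the size of the input. -/
inductive Code where
  | skip
  | assign (x : ℕ) (e : Expr)
  | store (k : ℕ) (a b : Expr)
  | seq (p q : Code)
  | ifLt (a b : Expr) (p q : Code)
  | ifEq (a b : Expr) (p q : Code)
  | forSize (x : ℕ) (p : Code)

theorem State.setReg_reg (s : State) (r v x : ℕ) :
    (s.setReg r v).reg x = if x = r then v else s.reg x := Function.update_apply _ _ _ _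

theorem State.setReg_reg_of_ne (s : State) {r x : ℕ} (v : ℕ) (h : x ≠ r) :
    (s.setReg r v).reg x = s.reg x := Function.update_of_ne h _ _

theorem State.setReg_arr (s : State) (r v : ℕ) : (s.setReg r v).arr = s.arr := rfl

theorem State.setArr_reg (s : State) (k i v : ℕ) : (s.setArr k i v).reg = s.reg := rfl

theorem State.setArr_arr (s : State) (k i v j l : ℕ) :
    (s.setArr k i v).arr j l = if j = k ∧ l = i then v else s.arr j l := by
  simp only [State.setArr, Function.update_apply]
  split_ifs <;> simp_all

/-- Do `f` and increment register `x`. -/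
def State.stepBy (x : ℕ) (f : State → State) (s : State) : State :=
  (f s).setReg x ((f s).reg x + 1)

namespace Code

/-- The effect of code on a state. -/
def eval : Code → State → State
  | skip, s => s
  | assign x e, s => s.setReg x (e.eval s)
  | store k a b, s => s.setArr k (a.eval s) (b.eval s)
  | seq p q, s => q.eval (p.eval s)
  | ifLt a b p q, s => if a.eval s < b.eval s then p.eval s else q.eval s
  | ifEq a b p q, s => if a.eval s = b.eval s then p.eval s else q.eval s
  | forSize x p, s => (State.stepBy x p.eval)^[s.reg 0] (s.setReg x 0)

theorem eval_seq (p q : Code) (s : State) : (seq p q).eval s = q.eval (p.eval s) := rfl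

/-- The registers that the code may change. -/
def writes : Code → List ℕ
  | skip => []
  | assign x _ => [x]
  | store _ _ _ => []
  | seq p q => p.writes ++ q.writes
  | ifLt _ _ p q => p.writes ++ q.writes
  | ifEq _ _ p q => p.writes ++ q.writes
  | forSize x p => x :: p.writes

/-- The arrays that the code may change. -/
def arrWrites : Code → List ℕ
  | skip => []
  | assign _ _ => []
  | store k _ _ => [k]
  | seq p q => p.arrWrites ++ q.arrWrites
  | ifLt _ _ p q => p.arrWrites ++ q.arrWrites
  | ifEq _ _ p q => p.arrWrites ++ q.arrWrites
  | forSize _ p => p.arrWrites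

/-- The bodies of loops change neither the size nor the loop variable. -/
def WF : Code → Prop
  | skip => True
  | assign _ _ => True
  | store _ _ _ => True
  | seq p q => p.WF ∧ q.WF
  | ifLt _ _ p q => p.WF ∧ q.WF
  | ifEq _ _ p q => p.WF ∧ q.WF
  | forSize x p => p.WF ∧ x ∉ p.writes

/-- Well-formedness is decidable. -/
def decidableWF : (p : Code) → Decidable p.WF
  | skip => isTrue trivial
  | assign _ _ => isTrue trivial
  | store _ _ _ => isTrue trivial
  | seq p q => @instDecidableAnd _ _ p.decidableWF q.decidableWF
  | ifLt _ _ p q => @instDecidableAnd _ _ p.decidableWF q.decidableWF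
  | ifEq _ _ p q => @instDecidableAnd _ _ p.decidableWF q.decidableWF
  | forSize x p => @instDecidableAnd (p.WF) (x ∉ p.writes) p.decidableWF inferInstance

instance (p : Code) : Decidable p.WF := p.decidableWF

theorem eval_reg_of_notMem (p : Code) (s : State) {x : ℕ} (hx : x ∉ p.writes) :
    (p.eval s).reg x = s.reg x := by
  induction p generalizing s with
  | skip => rfl
  | assign y e =>
    simp only [writes, List.mem_singleton] at hx
    simp [eval, State.setReg, Function.update_of_ne hx]
  | store k a b => rfl
  | seq p q ihp ihq =>
    simp only [writes, List.mem_append, not_or] at hx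
    rw [eval, ihq _ hx.2, ihp _ hx.1]
  | ifLt a b p q ihp ihq =>
    simp only [writes, List.mem_append, not_or] at hx
    rw [eval]
    split_ifs
    · exact ihp _ hx.1
    · exact ihq _ hx.2
  | ifEq a b p q ihp ihq =>
    simp only [writes, List.mem_append, not_or] at hx
    rw [eval]
    split_ifs
    · exact ihp _ hx.1
    · exact ihq _ hx.2
  | forSize y p ih =>
    simp only [writes, List.mem_cons, not_or] at hx
    have h : ∀ m t, ((State.stepBy y p.eval)^[m] t).reg x = t.reg x := by
      intro m
      induction m with
      | zero => intro t; rfl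
      | succ m ihm =>
        intro t
        rw [Function.iterate_succ_apply', State.stepBy, State.setReg_reg_of_ne _ _ hx.1,
          ih _ hx.2, ihm]
    rw [eval, h, State.setReg_reg_of_ne _ _ hx.1]

theorem eval_arr_of_notMem (p : Code) (s : State) {k : ℕ} (hk : k ∉ p.arrWrites) :
    (p.eval s).arr k = s.arr k := by
  induction p generalizing s with
  | skip => rfl
  | assign y e => rfl
  | store k a b =>
    simp only [arrWrites, List.mem_singleton] at hk
    simp [eval, State.setArr, Function.update_of_ne hk]
  | seq p q ihp ihq =>
    simp only [arrWrites, List.mem_append, not_or] at hk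
    rw [eval, ihq _ hk.2, ihp _ hk.1]
  | ifLt a b p q ihp ihq =>
    simp only [arrWrites, List.mem_append, not_or] at hk
    rw [eval]
    split_ifs
    · exact ihp _ hk.1
    · exact ihq _ hk.2
  | ifEq a b p q ihp ihq =>
    simp only [arrWrites, List.mem_append, not_or] at hk
    rw [eval]
    split_ifs
    · exact ihp _ hk.1
    · exact ihq _ hk.2
  | forSize y p ih =>
    simp only [arrWrites] at hk
    have h : ∀ m t, ((State.stepBy y p.eval)^[m] t).arr k = t.arr k := by
      intro m
      induction m with
      | zero => intro t; rfl
      | succ m ihm =>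
        intro t
        rw [Function.iterate_succ_apply']
        exact (ih _ hk).trans (ihm t)
    rw [eval, h]
    rfl

/-- The invariant rule for loops: it may be assumed that the loop body starts in a state that
differs from the initial state only in places which the loop changes. -/
theorem forSize_inv {x : ℕ} {p : Code} (s : State) (I : ℕ → State → Prop)
    (hx : x ∉ p.writes) (h0 : I 0 (s.setReg x 0))
    (hstep : ∀ k < s.reg 0, ∀ t : State, t.reg x = k → (∀ y, y ≠ x → y ∉ p.writes →
      t.reg y = s.reg y) → (∀ j, j ∉ p.arrWrites → t.arr j = s.arr j) → I k t →
      I (k + 1) ((p.eval t).setReg x (k + 1))) :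
    I (s.reg 0) ((forSize x p).eval s) := by
  have h : ∀ m ≤ s.reg 0, ∀ t, t = (State.stepBy x p.eval)^[m] (s.setReg x 0) →
      t.reg x = m ∧ (∀ y, y ≠ x → y ∉ p.writes → t.reg y = s.reg y) ∧
      (∀ j, j ∉ p.arrWrites → t.arr j = s.arr j) ∧ I m t := by
    intro m
    induction m with
    | zero =>
      rintro - t rfl
      refine ⟨by simp [State.setReg], fun y hy _ => ?_, fun j _ => rfl, h0⟩
      simp [State.setReg, Function.update_of_ne hy]
    | succ m ih =>
      rintro hm _ rfl
      obtain ⟨h1, h2, h3, h4⟩ := ih (by omega) _ rfl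
      rw [Function.iterate_succ_apply']
      set t := (State.stepBy x p.eval)^[m] (s.setReg x 0)
      have hs := hstep m (by omega) t h1 h2 h3 h4
      have hxt : (p.eval t).reg x = m := by rw [eval_reg_of_notMem p t hx, h1]
      rw [State.stepBy, hxt]
      refine ⟨by simp [State.setReg], fun y hy hyp => ?_, fun j hj => ?_, hs⟩
      · rw [State.setReg_reg_of_ne _ _ hy, eval_reg_of_notMem p t hyp, h2 y hy hyp]
      · exact (eval_arr_of_notMem p t hj).trans (h3 j hj)
  exact (h (s.reg 0) le_rfl _ rfl).2.2.2

end Code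

/-- The part of the state which the variables of the code represent. -/
def State.evens (s : State) : State where
  reg x := s.reg (2 * x)
  arr := s.arr

theorem State.evens_setReg_even (s : State) (x v : ℕ) :
    (s.setReg (2 * x) v).evens = s.evens.setReg x v := by
  simp only [State.evens, State.setReg, State.mk.injEq, and_true]
  funext y
  simp [Function.update_apply]

theorem State.evens_congr {s s' : State} (h : ∀ x, s'.reg (2 * x) = s.reg (2 * x))
    (ha : s'.arr = s.arr) : s'.evens = s.evens := by
  simp only [State.evens, State.mk.injEq, ha, and_true]
  funext x
  exact h x

/-- Compute the value of an expression into register `2 * d + 1`. -/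
def Expr.compile : Expr → ℕ → Program
  | lit c, d => .const (2 * d + 1) c
  | var x, d => .copy (2 * d + 1) (2 * x)
  | add a b, d => .seq (a.compile d)
      (.seq (b.compile (d + 1)) (.add (2 * d + 1) (2 * d + 1) (2 * d + 3)))
  | load k a, d => .seq (a.compile d) (.load (2 * d + 1) k (2 * d + 1))
  | mulSize a, d => .seq (a.compile (d + 1)) (.seq (.const (2 * d + 1) 0)
      (.seq (.const (2 * d + 5) 0) (.seq (.const (2 * d + 7) 1)
        (.loop (.lt (2 * d + 5) 0) (.seq (.add (2 * d + 1) (2 * d + 1) (2 * d + 3))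
          (.add (2 * d + 5) (2 * d + 5) (2 * d + 7)))))))

open Polynomial in
/-- A bound for the number of steps, in terms of the size of the input. -/
noncomputable def Expr.cost : Expr → Polynomial ℕ
  | lit _ => 1
  | var _ => 1
  | add a b => a.cost + b.cost + 1
  | load _ a => a.cost + 1
  | mulSize a => a.cost + 3 + (3 * X + 1)

/-- The odd registers serve as an evaluation stack with d as its height. Preservation of the
registers below `2 * d + 1` keeps operands computed earlier, and preservation of the even registers
keeps the variables. -/
theorem Expr.compile_spec (e : Expr) (d : ℕ) (s : State) : ∃ T s', Exec (e.compile d) s T s' ∧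
    T ≤ e.cost.eval (s.reg 0) ∧ s'.arr = s.arr ∧ s'.reg (2 * d + 1) = e.eval s.evens ∧
    (∀ x, s'.reg (2 * x) = s.reg (2 * x)) ∧ ∀ r < 2 * d + 1, s'.reg r = s.reg r := by
  induction e generalizing d s with
  | lit c =>
    refine ⟨_, _, .const _ _ _, by simp [cost], rfl, by simp [State.setReg, eval],
      fun x => ?_, fun r hr => ?_⟩ <;>
    exact Function.update_of_ne (by omega) _ _
  | var x =>
    refine ⟨_, _, .copy _ _ _, by simp [cost], rfl, by simp [State.setReg, eval, State.evens],
      fun x => ?_, fun r hr => ?_⟩ <;>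
    exact Function.update_of_ne (by omega) _ _
  | add a b iha ihb =>
    obtain ⟨T₁, s₁, h₁, t₁, a₁, r₁, e₁, l₁⟩ := iha d s
    obtain ⟨T₂, s₂, h₂, t₂, a₂, r₂, e₂, l₂⟩ := ihb (d + 1) s₁
    refine ⟨_, _, .seq h₁ (.seq h₂ (.add _ _ _ _)), ?_, ?_, ?_, fun x => ?_, fun r hr => ?_⟩
    · have := e₁ 0
      simp only [mul_zero] at this
      rw [this] at t₂
      simp only [cost, Polynomial.eval_add, Polynomial.eval_one]
      omega
    · exact a₂.trans a₁
    · have : s₂.reg (2 * d + 3) = b.eval s.evens := by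
        rw [← State.evens_congr e₁ a₁, ← r₂]
        congr 1
      simp [State.setReg, eval, this, l₂ (2 * d + 1) (by omega), r₁]
    · exact (Function.update_of_ne (by omega) _ _).trans ((e₂ x).trans (e₁ x))
    · exact (Function.update_of_ne (by omega) _ _).trans ((l₂ r (by omega)).trans (l₁ r hr))
  | load k a ih =>
    obtain ⟨T₁, s₁, h₁, t₁, a₁, r₁, e₁, l₁⟩ := ih d s
    refine ⟨_, _, .seq h₁ (.load _ _ _ _), ?_, a₁, ?_, fun x => ?_, fun r hr => ?_⟩
    · simp only [cost, Polynomial.eval_add, Polynomial.eval_one]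
      omega
    · simp [State.setReg, eval, r₁, a₁, State.evens]
    · exact (Function.update_of_ne (by omega) _ _).trans (e₁ x)
    · exact (Function.update_of_ne (by omega) _ _).trans (l₁ r hr)
  | mulSize a ih =>
    obtain ⟨T₁, s₁, h₁, t₁, a₁, r₁, e₁, l₁⟩ := ih (d + 1) s
    -- Multiplication by repeated addition: `2 * d + 1` accumulates, `2 * d + 3` holds the factor,
    -- `2 * d + 5` counts up to the size, and m is the number of rounds left.
    have loop : ∀ m (t : State), t.reg (2 * d + 5) + m = t.reg 0 → t.reg (2 * d + 7) = 1 →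
        ∃ t', Exec (.loop (.lt (2 * d + 5) 0) (.seq (.add (2 * d + 1) (2 * d + 1) (2 * d + 3))
          (.add (2 * d + 5) (2 * d + 5) (2 * d + 7)))) t (3 * m + 1) t' ∧ t'.arr = t.arr ∧
          t'.reg (2 * d + 1) = t.reg (2 * d + 1) + t.reg (2 * d + 3) * m ∧
          ∀ r, r ≠ 2 * d + 1 → r ≠ 2 * d + 5 → t'.reg r = t.reg r := by
      intro m
      induction m with
      | zero =>
        intro t ht _
        refine ⟨t, .loop_exit (by simp [Cond.Holds]; omega), rfl, by simp, fun _ _ _ => rfl⟩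
      | succ m ihm =>
        intro t ht h1
        set t₂ := (t.setReg (2 * d + 1) (t.reg (2 * d + 1) + t.reg (2 * d + 3))).setReg (2 * d + 5)
          (t.reg (2 * d + 5) + 1) with ht₂
        have hx : Exec (.seq (.add (2 * d + 1) (2 * d + 1) (2 * d + 3))
          (.add (2 * d + 5) (2 * d + 5) (2 * d + 7))) t (1 + 1) t₂ := by
          have := Exec.seq (.add (2 * d + 1) (2 * d + 1) (2 * d + 3) t)
            (.add (2 * d + 5) (2 * d + 5) (2 * d + 7) _)
          simpa [ht₂, State.setReg, Function.update_apply, h1] using this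
        have hr : ∀ r, r ≠ 2 * d + 1 → r ≠ 2 * d + 5 → t₂.reg r = t.reg r := fun r h h' => by
          simp [ht₂, State.setReg, h, h']
        have hr1 : t₂.reg (2 * d + 1) = t.reg (2 * d + 1) + t.reg (2 * d + 3) := by
          simp [ht₂, State.setReg]
        have hr5 : t₂.reg (2 * d + 5) = t.reg (2 * d + 5) + 1 := by
          simp [ht₂, State.setReg]
        obtain ⟨t', e, b, c, f⟩ := ihm t₂
          (by rw [hr5, hr 0 (by omega) (by omega)]; omega)
          (by rw [hr _ (by omega) (by omega), h1])
        refine ⟨t', ?_, b, ?_, fun r h h' => (f r h h').trans (hr r h h')⟩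
        · have := Exec.loop_step (c := .lt (2 * d + 5) 0) (by simp [Cond.Holds]; omega) hx e
          convert this using 1
          ring
        · rw [c, hr1, hr _ (by omega) (by omega)]
          ring
    obtain ⟨t', e, b, c, f⟩ := loop (s.reg 0)
      (((s₁.setReg (2 * d + 1) 0).setReg (2 * d + 5) 0).setReg (2 * d + 7) 1)
      (by simpa [State.setReg, Function.update_apply] using (e₁ 0).symm)
      (by simp [State.setReg])
    have hf : ∀ r, r ≠ 2 * d + 1 → r ≠ 2 * d + 5 → r ≠ 2 * d + 7 → t'.reg r = s₁.reg r := by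
      intro r h h' h''
      rw [f r h h']
      simp [State.setReg, h, h', h'']
    refine ⟨_, _, .seq h₁ (.seq (.const _ _ _) (.seq (.const _ _ _) (.seq (.const _ _ _) e))),
      ?_, ?_, ?_, fun x => ?_, fun r hr => ?_⟩
    · simp only [cost, Polynomial.eval_add, Polynomial.eval_mul, Polynomial.eval_X,
        Polynomial.eval_one, Polynomial.eval_ofNat]
      omega
    · rw [b]; exact a₁
    · rw [c]
      have h3 : s₁.reg (2 * d + 3) = a.eval s.evens := r₁
      simp [State.setReg, h3, eval, State.evens]
    · rw [hf _ (by omega) (by omega) (by omega), e₁]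
    · rw [hf _ (by omega) (by omega) (by omega), l₁ r (by omega)]

/-! ### Compilation of code and its polynomial cost -/

namespace Code

/-- The machine program for the code. -/
def compile : Code → Program
  | skip => .skip
  | assign x e => .seq (e.compile 0) (.copy (2 * x) 1)
  | store k a b => .seq (a.compile 0) (.seq (b.compile 1) (.store k 1 3))
  | seq p q => .seq p.compile q.compile
  | ifLt a b p q => .seq (a.compile 0) (.seq (b.compile 1) (.ite (.lt 1 3) p.compile q.compile))
  | ifEq a b p q => .seq (a.compile 0) (.seq (b.compile 1) (.ite (.eq 1 3) p.compile q.compile))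
  | forSize x p => .seq (.const (2 * x) 0) (.loop (.lt (2 * x) 0)
      (.seq p.compile (.seq (.const 1 1) (.add (2 * x) (2 * x) 1))))

open Polynomial in
/-- A bound for the number of steps, in terms of the size of the input. -/
noncomputable def cost : Code → Polynomial ℕ
  | skip => 1
  | assign _ e => e.cost + 1
  | store _ a b => a.cost + (b.cost + 1)
  | seq p q => p.cost + q.cost
  | ifLt a b p q => a.cost + (b.cost + (p.cost + q.cost + 1))
  | ifEq a b p q => a.cost + (b.cost + (p.cost + q.cost + 1))
  | forSize _ p => 1 + (X * (p.cost + 3) + 1)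

theorem compile_two_exprs (a b : Expr) (s : State) : ∃ T₁ T₂ s₁ s₂, Exec (a.compile 0) s T₁ s₁ ∧
    Exec (b.compile 1) s₁ T₂ s₂ ∧ T₁ ≤ a.cost.eval (s.reg 0) ∧ T₂ ≤ b.cost.eval (s.reg 0) ∧
    s₂.evens = s.evens ∧ s₂.reg 1 = a.eval s.evens ∧ s₂.reg 3 = b.eval s.evens := by
  obtain ⟨T₁, s₁, h₁, t₁, a₁, r₁, e₁, l₁⟩ := a.compile_spec 0 s
  obtain ⟨T₂, s₂, h₂, t₂, a₂, r₂, e₂, l₂⟩ := b.compile_spec 1 s₁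
  have he := State.evens_congr e₁ a₁
  refine ⟨T₁, T₂, s₁, s₂, h₁, h₂, t₁, ?_, ?_, ?_, ?_⟩
  · have := e₁ 0
    simp only [mul_zero] at this
    rwa [this] at t₂
  · rw [State.evens_congr e₂ a₂, he]
  · rw [l₂ 1 (by omega)]; exact r₁
  · rw [← he]; exact r₂

/-- Only the even registers and the arrays carry meaning, so agreement is asserted for `evens`. As
the code never writes variable 0, the size is the same throughout and all costs are polynomials in
one number. -/
theorem compile_spec (p : Code) (hp : p.WF) (h0 : 0 ∉ p.writes) (s : State) :
    ∃ T s', Exec p.compile s T s' ∧ T ≤ p.cost.eval (s.reg 0) ∧ s'.evens = p.eval s.evens := by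
  induction p generalizing s with
  | skip => exact ⟨_, _, .skip _, by simp [cost], rfl⟩
  | assign x e =>
    obtain ⟨T₁, s₁, h₁, t₁, a₁, r₁, e₁, l₁⟩ := e.compile_spec 0 s
    refine ⟨_, _, .seq h₁ (.copy _ _ _), ?_, ?_⟩
    · simp only [cost, Polynomial.eval_add, Polynomial.eval_one]
      omega
    · rw [State.evens_setReg_even, State.evens_congr e₁ a₁]
      simp only [mul_zero, zero_add] at r₁
      rw [r₁, eval]
  | store k a b =>
    obtain ⟨T₁, T₂, s₁, s₂, h₁, h₂, t₁, t₂, he, r₁, r₂⟩ := compile_two_exprs a b s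
    refine ⟨_, _, .seq h₁ (.seq h₂ (.store _ _ _ _)), ?_, ?_⟩
    · simp only [cost, Polynomial.eval_add, Polynomial.eval_one]
      omega
    · rw [eval, r₁, r₂, ← he]
      rfl
  | seq p q ihp ihq =>
    simp only [writes, List.mem_append, not_or] at h0
    obtain ⟨T₁, s₁, h₁, t₁, e₁⟩ := ihp hp.1 h0.1 s
    obtain ⟨T₂, s₂, h₂, t₂, e₂⟩ := ihq hp.2 h0.2 s₁
    refine ⟨_, _, .seq h₁ h₂, ?_, ?_⟩
    · have : s₁.reg 0 = s.reg 0 := by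
        have := congrArg (fun t => State.reg t 0) e₁
        rw [eval_reg_of_notMem p _ h0.1] at this
        exact this
      rw [this] at t₂
      simp only [cost, Polynomial.eval_add]
      omega
    · rw [e₂, e₁, eval]
  | ifLt a b p q ihp ihq =>
    simp only [writes, List.mem_append, not_or] at h0
    obtain ⟨T₁, T₂, s₁, s₂, h₁, h₂, t₁, t₂, he, r₁, r₂⟩ := compile_two_exprs a b s
    have hs : s₂.reg 0 = s.reg 0 := by
      have := congrArg (fun t => State.reg t 0) he
      exact this
    simp only [cost, Polynomial.eval_add, Polynomial.eval_one, eval]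
    by_cases hc : a.eval s.evens < b.eval s.evens
    · obtain ⟨T₃, s₃, h₃, t₃, e₃⟩ := ihp hp.1 h0.1 s₂
      rw [hs] at t₃
      refine ⟨_, _, .seq h₁ (.seq h₂ (.ite_true (by simpa [Cond.Holds, r₁, r₂]) h₃)), by omega, ?_⟩
      rw [if_pos hc, e₃, he]
    · obtain ⟨T₃, s₃, h₃, t₃, e₃⟩ := ihq hp.2 h0.2 s₂
      rw [hs] at t₃
      refine ⟨_, _, .seq h₁ (.seq h₂ (.ite_false (by simpa [Cond.Holds, r₁, r₂] using hc) h₃)),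
        by omega, ?_⟩
      rw [if_neg hc, e₃, he]
  | ifEq a b p q ihp ihq =>
    simp only [writes, List.mem_append, not_or] at h0
    obtain ⟨T₁, T₂, s₁, s₂, h₁, h₂, t₁, t₂, he, r₁, r₂⟩ := compile_two_exprs a b s
    have hs : s₂.reg 0 = s.reg 0 := by
      have := congrArg (fun t => State.reg t 0) he
      exact this
    simp only [cost, Polynomial.eval_add, Polynomial.eval_one, eval]
    by_cases hc : a.eval s.evens = b.eval s.evens
    · obtain ⟨T₃, s₃, h₃, t₃, e₃⟩ := ihp hp.1 h0.1 s₂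
      rw [hs] at t₃
      refine ⟨_, _, .seq h₁ (.seq h₂ (.ite_true (by simpa [Cond.Holds, r₁, r₂]) h₃)), by omega, ?_⟩
      rw [if_pos hc, e₃, he]
    · obtain ⟨T₃, s₃, h₃, t₃, e₃⟩ := ihq hp.2 h0.2 s₂
      rw [hs] at t₃
      refine ⟨_, _, .seq h₁ (.seq h₂ (.ite_false (by simpa [Cond.Holds, r₁, r₂] using hc) h₃)),
        by omega, ?_⟩
      rw [if_neg hc, e₃, he]
  | forSize x p ih =>
    simp only [writes, List.mem_cons, not_or] at h0
    have loop : ∀ m (t : State), t.reg (2 * x) + m = t.reg 0 → ∃ T t',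
        Exec (.loop (.lt (2 * x) 0)
          (.seq p.compile (.seq (.const 1 1) (.add (2 * x) (2 * x) 1)))) t T t' ∧
        T ≤ m * (p.cost.eval (t.reg 0) + 3) + 1 ∧
        t'.evens = (State.stepBy x p.eval)^[m] t.evens := by
      intro m
      induction m with
      | zero =>
        intro t ht
        exact ⟨_, t, .loop_exit (by simp [Cond.Holds]; omega), by simp, rfl⟩
      | succ m ihm =>
        intro t ht
        obtain ⟨T₁, t₁, h₁, c₁, e₁⟩ := ih hp.1 h0.2 t
        have hx : t₁.reg (2 * x) = t.reg (2 * x) := by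
          have := congrArg (fun t => State.reg t x) e₁
          rw [eval_reg_of_notMem p _ hp.2] at this
          exact this
        have hz : t₁.reg 0 = t.reg 0 := by
          have := congrArg (fun t => State.reg t 0) e₁
          rw [eval_reg_of_notMem p _ h0.2] at this
          exact this
        set t₂ := (t₁.setReg 1 1).setReg (2 * x) (t₁.reg (2 * x) + 1) with ht₂
        have hE : Exec (.seq (.const 1 1) (.add (2 * x) (2 * x) 1)) t₁ (1 + 1) t₂ := by
          have := Exec.seq (.const 1 1 t₁) (.add (2 * x) (2 * x) 1 _)
          have h21 : 2 * x ≠ 1 := by omega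
          simpa [ht₂, State.setReg, Function.update_apply, h21] using this
        have e₂ : t₂.evens = State.stepBy x p.eval t.evens := by
          rw [ht₂, State.evens_setReg_even, State.stepBy, ← e₁]
          congr 1
          exact State.evens_congr (fun y => Function.update_of_ne (by omega) _ _) rfl
        have h2x : t₂.reg (2 * x) = t.reg (2 * x) + 1 := by simp [ht₂, State.setReg, hx]
        have h20 : t₂.reg 0 = t.reg 0 := by
          have : 0 ≠ 2 * x := by omega
          rw [← hz]
          simp [ht₂, State.setReg, Function.update_apply]
          omega
        obtain ⟨T₃, t₃, h₃, c₃, e₃⟩ := ihm t₂ (by omega)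
        refine ⟨_, t₃, .loop_step (by simp [Cond.Holds]; omega) (.seq h₁ hE) h₃, ?_, ?_⟩
        · rw [h20] at c₃
          rw [Nat.succ_mul]
          omega
        · rw [e₃, e₂, Function.iterate_succ_apply]
    have h2x : (0 : ℕ) ≠ 2 * x := by have := h0.1; omega
    have hz : (s.setReg (2 * x) 0).reg 0 = s.reg 0 := Function.update_of_ne h2x _ _
    obtain ⟨T, t', h, c, e⟩ := loop (s.reg 0) (s.setReg (2 * x) 0) (by
      rw [hz]; simp [State.setReg])
    refine ⟨_, _, .seq (.const _ _ _) h, ?_, ?_⟩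
    · rw [hz] at c
      simp only [cost, Polynomial.eval_add, Polynomial.eval_mul, Polynomial.eval_X,
        Polynomial.eval_one, Polynomial.eval_ofNat]
      omega
    · rw [e, State.evens_setReg_even, eval]
      rfl

end Code

end RAM

/-! ### Shortest paths -/

theorem SimpleGraph.Reachable.dist_lt_card {V : Type*} [Fintype V] {G : SimpleGraph V} {u v : V}
    (h : G.Reachable u v) : G.dist u v < Fintype.card V := by
  obtain ⟨p, hp, hl⟩ := h.exists_path_of_dist
  exact hl ▸ hp.length_lt

namespace RAM

/-- Do `p` if the contents of the registers `u` and `v` are adjacent. -/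
def Code.whenAdj (u v : ℕ) (p : Code) : Code :=
  .ifEq (.load 0 (.add (.mulSize (.var u)) (.var v))) (.lit 1) p .skip

/-- Relax the edge from the vertex in register `3` to the vertex in register `4`. -/
def relaxEdge : Code :=
  .whenAdj 3 4 (.ifLt (.add (.load 3 (.var 3)) (.lit 1)) (.load 3 (.var 4))
    (.store 3 (.var 4) (.add (.load 3 (.var 3)) (.lit 1))) .skip)

/-- Relax all edges. -/
def relaxAll : Code := .forSize 3 (.forSize 4 relaxEdge)

/-- Compute the distances from the vertex in register `1` into array `3`; unreachable vertices get
the number of vertices as their distance. -/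
def bfs : Code :=
  .seq (.forSize 3 (.store 3 (.var 3) (.var 0)))
    (.seq (.store 3 (.var 1) (.lit 0)) (.forSize 2 relaxAll))

variable {n : ℕ}

/-- The size and the adjacency matrix of `G` are in place. -/
structure HasInput (G : SimpleGraph (Fin n)) (s : State) : Prop where
  size : s.reg 0 = n
  adj : ∀ a b : Fin n, s.arr 0 (a * n + b) = 1 ↔ G.Adj a b

variable {G : SimpleGraph (Fin n)}

theorem hasInput_inputState (G : SimpleGraph (Fin n)) : HasInput G (inputState G).evens := by
  refine ⟨by simp [State.evens, inputState], fun a b => ?_⟩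
  simp only [State.evens, inputState, true_and]
  constructor
  · intro h
    split_ifs at h with h'
    · obtain ⟨-, u, v, huv, hadj⟩ := h'
      have hn : 0 < n := a.pos
      have h1 : a = u := Fin.ext (by
        have := congrArg (· / n) huv
        simpa [Nat.mul_add_div, mul_comm _ n, hn, Nat.div_eq_of_lt] using this)
      subst h1
      have h2 : b = v := Fin.ext (by omega)
      rwa [h2]
  · intro h
    rw [if_pos ⟨rfl, a, b, rfl, h⟩]

theorem HasInput.congr {s t : State} (h : HasInput G s) (h0 : t.reg 0 = s.reg 0)
    (ha : t.arr 0 = s.arr 0) : HasInput G t :=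
  ⟨h0.trans h.size, fun a b => by rw [ha]; exact h.adj a b⟩

theorem HasInput.eval {s : State} (h : HasInput G s) (p : Code) (h0 : 0 ∉ p.writes)
    (ha : 0 ∉ p.arrWrites) : HasInput G (p.eval s) :=
  h.congr (p.eval_reg_of_notMem s h0) (p.eval_arr_of_notMem s ha)

theorem Code.whenAdj_eval {s : State} (h : HasInput G s) {u v : ℕ} {a b : Fin n}
    (hu : s.reg u = a) (hv : s.reg v = b) (p : Code) [Decidable (G.Adj a b)] :
    (Code.whenAdj u v p).eval s = if G.Adj a b then p.eval s else s := by
  simp only [Code.whenAdj, Code.eval, Expr.eval, hu, hv, h.size, h.adj]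

/-- The finite entries of array `3` are lengths of walks from `src`. -/
def DistSound (G : SimpleGraph (Fin n)) (src : Fin n) (A : ℕ → ℕ) : Prop :=
  ∀ v : Fin n, A v ≤ n ∧ (A v < n → G.Reachable src v ∧ G.dist src v ≤ A v)

/-- The value n acts as infinity: the comparison is strict and entries are at most n, so a store can
only happen when the entry of v is a genuine bound. -/
theorem relaxEdge_spec {s : State} (h : HasInput G s) {src v w : Fin n} (hv : s.reg 3 = v)
    (hw : s.reg 4 = w) (hs : DistSound G src (s.arr 3)) :
    (∀ x : Fin n, (relaxEdge.eval s).arr 3 x ≤ s.arr 3 x) ∧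
    DistSound G src ((relaxEdge.eval s).arr 3) ∧
    (G.Adj v w → (relaxEdge.eval s).arr 3 w ≤ s.arr 3 v + 1) := by
  classical
  rw [relaxEdge, Code.whenAdj_eval h hv hw]
  split_ifs with hvw
  · simp only [Code.eval, Expr.eval, hv, hw]
    split_ifs with hlt
    · simp only [State.setArr_arr, true_and]
      refine ⟨fun x => ?_, fun x => ?_, fun _ => by simp⟩
      · split_ifs with hx
        · rw [hx]; omega
        · rfl
      · simp only [State.setArr_arr, true_and]
        split_ifs with hx
        · have hxw : x = w := Fin.ext hx
          subst hxw
          have h1 := (hs x).1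
          obtain ⟨h2, h3⟩ := (hs v).2 (by omega)
          have h4 := h2.dist_triangle_left x
          rw [SimpleGraph.dist_eq_one_iff_adj.mpr hvw] at h4
          exact ⟨by omega, fun _ => ⟨h2.trans hvw.reachable, by omega⟩⟩
        · exact hs x
    · exact ⟨fun x => le_rfl, hs, fun _ => by omega⟩
  · exact ⟨fun x => le_rfl, hs, fun h => absurd h hvw⟩

theorem relaxAll_spec {s : State} (h : HasInput G s) {src : Fin n}
    (hs : DistSound G src (s.arr 3)) :
    (∀ x : Fin n, (relaxAll.eval s).arr 3 x ≤ s.arr 3 x) ∧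
    DistSound G src ((relaxAll.eval s).arr 3) ∧
    ∀ v w : Fin n, G.Adj v w → (relaxAll.eval s).arr 3 w ≤ s.arr 3 v + 1 := by
  -- The bounds refer to the entries before the sweep. Entries only decrease, so relaxing with newer
  -- values is at least as good.
  have key := Code.forSize_inv (x := 3) (p := .forSize 4 relaxEdge) s
    (fun k t => (∀ x : Fin n, t.arr 3 x ≤ s.arr 3 x) ∧ DistSound G src (t.arr 3) ∧
      ∀ v w : Fin n, (v : ℕ) < k → G.Adj v w → t.arr 3 w ≤ s.arr 3 v + 1) (by decide)
    ⟨fun _ => le_rfl, hs, by simp⟩ ?_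
  · rw [h.size] at key
    exact ⟨key.1, key.2.1, fun v w => key.2.2 v w v.2⟩
  intro k hk t htk htr hta ⟨i1, i2, i3⟩
  rw [h.size] at hk
  have ht : HasInput G t := h.congr (htr 0 (by decide) (by decide)) (hta 0 (by decide))
  have key := Code.forSize_inv (x := 4) (p := relaxEdge) t
    (fun j u => (∀ x : Fin n, u.arr 3 x ≤ t.arr 3 x) ∧ DistSound G src (u.arr 3) ∧
      ∀ w : Fin n, (w : ℕ) < j → G.Adj ⟨k, hk⟩ w → u.arr 3 w ≤ t.arr 3 k + 1) (by decide)
    ⟨fun _ => le_rfl, i2, by simp⟩ ?_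
  · rw [ht.size] at key
    obtain ⟨k1, k2, k3⟩ := key
    refine ⟨fun x => (k1 x).trans (i1 x), k2, fun v w hv hvw => ?_⟩
    rcases Nat.lt_succ_iff_lt_or_eq.mp hv with hv | hv
    · exact (k1 w).trans (i3 v w hv hvw)
    · have hvk : v = ⟨k, hk⟩ := Fin.ext hv
      subst hvk
      exact (k3 w w.2 hvw).trans (Nat.add_le_add_right (i1 ⟨k, hk⟩) 1)
  intro j hj u huj hur hua ⟨j1, j2, j3⟩
  rw [ht.size] at hj
  have hu : HasInput G u := ht.congr (hur 0 (by decide) (by decide)) (hua 0 (by decide))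
  obtain ⟨r1, r2, r3⟩ := relaxEdge_spec (v := ⟨k, hk⟩) (w := ⟨j, hj⟩) hu
    ((hur 3 (by decide) (by decide)).trans htk) huj j2
  simp only [State.setReg_arr]
  refine ⟨fun x => (r1 x).trans (j1 x), r2, fun w hw hkw => ?_⟩
  rcases Nat.lt_succ_iff_lt_or_eq.mp hw with hw | hw
  · exact (r1 w).trans (j3 w hw hkw)
  · have hwj : w = ⟨j, hj⟩ := Fin.ext hw
    subst hwj
    exact (r3 hkw).trans (Nat.add_le_add_right (j1 ⟨k, hk⟩) 1)

/-- After k sweeps the entries are correct up to distance k, by looking at the last edge of a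
shortest path. Since finite distances are below n, n sweeps suffice, and an entry n at the end means
unreachable. -/
theorem bfs_spec {s : State} (h : HasInput G s) {src : Fin n} (hsrc : s.reg 1 = src)
    (v : Fin n) :
    (G.Reachable src v → (bfs.eval s).arr 3 v = G.dist src v) ∧
    ((bfs.eval s).arr 3 v < n ↔ G.Reachable src v) := by
  set s₁ := (Code.forSize 3 (.store 3 (.var 3) (.var 0))).eval s with hs₁
  have h₁ : HasInput G s₁ := h.eval _ (by decide) (by decide)
  have hA₁ : ∀ x : Fin n, s₁.arr 3 x = n := by
    have key := Code.forSize_inv (x := 3) (p := .store 3 (.var 3) (.var 0)) s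
      (fun k t => ∀ x : Fin n, (x : ℕ) < k → t.arr 3 x = n) (by decide) (by simp) ?_
    · exact fun x => key x (by rw [h.size]; exact x.2)
    intro k hk t htk htr hta hI x hx
    simp only [State.setReg_arr, Code.eval, Expr.eval, State.setArr_arr, true_and, htk,
      htr 0 (by decide) (by decide), h.size]
    split_ifs with hxk
    · rfl
    · exact hI x (by omega)
  have hsrc₁ : s₁.reg 1 = src := (Code.eval_reg_of_notMem _ _ (by decide)).trans hsrc
  set s₂ := (Code.store 3 (.var 1) (.lit 0)).eval s₁ with hs₂
  have h₂ : HasInput G s₂ := h₁.eval _ (by decide) (by decide)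
  have hA₂ : ∀ x : Fin n, s₂.arr 3 x = if x = src then 0 else n := by
    intro x
    simp only [hs₂, Code.eval, Expr.eval, State.setArr_arr, hsrc₁, true_and, hA₁, Fin.ext_iff]
  have key := Code.forSize_inv (x := 2) (p := relaxAll) s₂
    (fun k t => DistSound G src (t.arr 3) ∧
      ∀ x : Fin n, G.Reachable src x → G.dist src x ≤ k → t.arr 3 x ≤ G.dist src x) (by decide)
    ?_ ?_
  · change DistSound G src ((bfs.eval s).arr 3) ∧ _ at key
    obtain ⟨k1, k2⟩ := key
    rw [h₂.size] at k2
    have hle : ∀ hr : G.Reachable src v, (bfs.eval s).arr 3 v ≤ G.dist src v := fun hr =>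
      k2 v hr (by simpa using hr.dist_lt_card.le)
    have hlt : ∀ hr : G.Reachable src v, (bfs.eval s).arr 3 v < n := fun hr =>
      (hle hr).trans_lt (by simpa using hr.dist_lt_card)
    exact ⟨fun hr => le_antisymm (hle hr) ((k1 v).2 (hlt hr)).2, fun hv => ((k1 v).2 hv).1, hlt⟩
  · refine ⟨fun x => ?_, fun x hx hx0 => ?_⟩
    · simp only [State.setReg_arr, hA₂]
      split_ifs with hx
      · subst hx
        exact ⟨Nat.zero_le _, fun _ => ⟨SimpleGraph.Reachable.rfl, by simp⟩⟩
      · exact ⟨le_rfl, fun h => absurd h (lt_irrefl _)⟩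
    · have : src = x := hx.dist_eq_zero_iff.mp (by omega)
      subst this
      simp [State.setReg_arr, hA₂]
  · intro k hk t htk htr hta ⟨i1, i2⟩
    have ht : HasInput G t := h₂.congr (htr 0 (by decide) (by decide)) (hta 0 (by decide))
    obtain ⟨r1, r2, r3⟩ := relaxAll_spec ht i1
    simp only [State.setReg_arr]
    refine ⟨r2, fun x hx hxk => ?_⟩
    rcases hxk.lt_or_eq with hlt | heq
    · exact (r1 x).trans (i2 x hx (by omega))
    · obtain ⟨p, hp⟩ := hx.exists_walk_length_eq_dist
      have hg := p.isGeodesicSeq hp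
      have ha := hg.adj k (by omega)
      have hd := hg.dist_eq 0 k (by omega) (by omega)
      have hx' : p.getVert (k + 1) = x := by rw [← heq, ← hp]; simp
      rw [hx'] at ha
      simp only [SimpleGraph.Walk.getVert_zero] at hd
      have := r3 _ _ ha
      have := i2 (p.getVert k) (by simpa using hg.reachable (Nat.zero_le k) (by omega)) (by omega)
      omega

end RAM

/-! ### Roots and depths -/

section Root

variable {n : ℕ} (G : SimpleGraph (Fin n))

open Classical in
/-- The largest vertex in the component of `x`. -/
noncomputable def compRoot (x : Fin n) : Fin n :=
  (Finset.univ.filter fun v => G.Reachable x v).max'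
    ⟨x, by simp⟩

theorem compRoot_reachable (x : Fin n) : G.Reachable x (compRoot G x) := by
  classical
  have := Finset.max'_mem (Finset.univ.filter fun v => G.Reachable x v) ⟨x, by simp⟩
  simpa [compRoot] using this

theorem le_compRoot {x v : Fin n} (h : G.Reachable x v) : v ≤ compRoot G x := by
  classical
  exact Finset.le_max' (Finset.univ.filter fun v => G.Reachable x v) v (by simpa using h)

theorem isRootMap_compRoot : IsRootMap G (compRoot G) where
  reachable x := (compRoot_reachable G x).symm
  eq_of_reachable x y h := le_antisymm (le_compRoot G (h.symm.trans (compRoot_reachable G x)))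
    (le_compRoot G (h.trans (compRoot_reachable G y)))

/-- The distance from the root of the component. -/
noncomputable def depth (x : Fin n) : ℕ := G.dist (compRoot G x) x

theorem depth_lt (x : Fin n) : depth G x < n := by
  simpa [depth] using (compRoot_reachable G x).symm.dist_lt_card

variable {G}

theorem depth_le_add_dist {x y : Fin n} (h : G.Reachable x y) :
    depth G y ≤ depth G x + G.dist x y := by
  have := h.dist_triangle_right (compRoot G x)
  rwa [depth, depth, ← (isRootMap_compRoot G).eq_of_reachable x y h]

theorem rootLT_iff {x y : Fin n} : RootLT G (compRoot G) x y ↔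
    x ≠ y ∧ G.Reachable x y ∧ depth G y = depth G x + G.dist x y := Iff.rfl

end Root

/-! ### Computing the depths -/

namespace RAM

/-- Compute the depths of the vertices into array `4`. -/
def computeDepths : Code :=
  .forSize 5 (.seq (.assign 1 (.var 5)) (.seq bfs
    (.forSize 6 (.ifLt (.load 3 (.var 6)) (.var 0) (.store 4 (.var 5) (.load 3 (.var 6))) .skip))))

variable {n : ℕ} {G : SimpleGraph (Fin n)}

/-- The inner loop overwrites the entry at every reachable vertex in increasing order. The last
write belongs to the largest vertex of the component, which is why that vertex was taken as the
root. -/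
theorem computeDepths_spec {s : State} (h : HasInput G s) (x : Fin n) :
    (computeDepths.eval s).arr 4 x = depth G x := by
  have key := Code.forSize_inv (x := 5) (p := .seq (.assign 1 (.var 5)) (.seq bfs
    (.forSize 6 (.ifLt (.load 3 (.var 6)) (.var 0)
      (.store 4 (.var 5) (.load 3 (.var 6))) .skip)))) s
    (fun k t => ∀ x : Fin n, (x : ℕ) < k → t.arr 4 x = depth G x) (by decide) (by simp) ?_
  · exact key x (by rw [h.size]; exact x.2)
  intro k hk t htk htr hta hI x hx
  rw [h.size] at hk
  have ht : HasInput G t := h.congr (htr 0 (by decide) (by decide)) (hta 0 (by decide))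
  rw [Code.eval_seq, Code.eval_seq, State.setReg_arr]
  set u := bfs.eval ((Code.assign 1 (.var 5)).eval t) with hu
  have ht' : HasInput G ((Code.assign 1 (.var 5)).eval t) := ht.eval _ (by decide) (by decide)
  have hui : HasInput G u := ht'.eval _ (by decide) (by decide)
  have hu5 : u.reg 5 = k := by
    rw [hu, Code.eval_reg_of_notMem _ _ (by decide), Code.eval_reg_of_notMem _ _ (by decide), htk]
  have hu4 : u.arr 4 = t.arr 4 := by
    rw [hu, Code.eval_arr_of_notMem _ _ (by decide), Code.eval_arr_of_notMem _ _ (by decide)]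
  have hspec := bfs_spec ht' (src := ⟨k, hk⟩)
    (by simp [Code.eval, Expr.eval, State.setReg_reg, htk])
  rw [← hu] at hspec
  have key := Code.forSize_inv (x := 6)
    (p := .ifLt (.load 3 (.var 6)) (.var 0) (.store 4 (.var 5) (.load 3 (.var 6))) .skip) u
    (fun j w => (∀ y : Fin n, (y : ℕ) < k → w.arr 4 y = depth G y) ∧
      ∀ v : Fin n, (v : ℕ) < j → G.Reachable ⟨k, hk⟩ v →
        (∀ v' : Fin n, v < v' → (v' : ℕ) < j → ¬ G.Reachable ⟨k, hk⟩ v') →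
        w.arr 4 k = G.dist ⟨k, hk⟩ v) (by decide) ?_ ?_
  · rw [hui.size] at key
    rcases Nat.lt_succ_iff_lt_or_eq.mp hx with hx | hx
    · exact key.1 x hx
    · have hxk : x = ⟨k, hk⟩ := Fin.ext hx
      subst hxk
      rw [depth, SimpleGraph.dist_comm]
      exact key.2 _ (Fin.is_lt _) (compRoot_reachable G _)
        fun v' hv' _ hr => absurd (le_compRoot G hr) (not_le.mpr hv')
  · refine ⟨fun y hy => ?_, by simp⟩
    rw [State.setReg_arr, hu4]
    exact hI y hy
  · intro j hj w hwj hwr hwa ⟨i1, i2⟩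
    rw [hui.size] at hj
    have hw5 : w.reg 5 = k := (hwr 5 (by decide) (by decide)).trans hu5
    have hw3 : w.arr 3 = u.arr 3 := hwa 3 (by decide)
    have hw0 : w.reg 0 = n := (hwr 0 (by decide) (by decide)).trans hui.size
    obtain ⟨b1, b2⟩ := hspec ⟨j, hj⟩
    simp only [Code.eval, Expr.eval, hwj, hw0, hw5, State.setReg_arr, hw3]
    split_ifs with hc
    · have hr := b2.mp hc
      simp only [State.setArr_arr, true_and]
      refine ⟨fun y hy => by rw [if_neg (by omega)]; exact i1 y hy, fun v hv hvr hmax => ?_⟩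
      rw [if_pos trivial]
      have hvj : v = ⟨j, hj⟩ := by
        by_contra hne
        refine hmax ⟨j, hj⟩ ?_ (by simp) hr
        have : (v : ℕ) ≠ j := fun h => hne (Fin.ext h)
        exact Fin.lt_def.mpr (by simp only; omega)
      rw [hvj]
      exact b1 hr
    · have hr : ¬ G.Reachable ⟨k, hk⟩ ⟨j, hj⟩ := fun h => hc (b2.mpr h)
      refine ⟨i1, fun v hv hvr hmax => ?_⟩
      have : (v : ℕ) ≠ j := fun h => by
        have : v = ⟨j, hj⟩ := Fin.ext h
        exact hr (this ▸ hvr)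
      exact i2 v (by omega) hvr fun v' h1 h2 => hmax v' h1 (by omega)

/-! ### The auction -/

/-- The number that represents an optional vertex. -/
def encodeOpt (o : Option (Fin n)) : ℕ := o.elim n fun x => x

theorem encodeOpt_lt {o : Option (Fin n)} : encodeOpt o < n ↔ o ≠ none := by
  cases o <;> simp [encodeOpt]

theorem encodeOpt_eq_coe {o : Option (Fin n)} {x : Fin n} : encodeOpt o = x ↔ o = some x := by
  cases o with
  | none => simp [encodeOpt]; omega
  | some y => simp [encodeOpt, Fin.ext_iff]

/-- With the distances from the bidder in register `8` in array `3`, find a cheapest right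
neighbour of the bidder into register `9`, with its price in register `10`. -/
def findBest : Code :=
  .seq (.assign 9 (.var 0)) (.seq (.assign 10 (.var 0))
    (.forSize 11 (.ifLt (.load 5 (.var 11)) (.var 10) (.ifLt (.load 3 (.var 11)) (.var 0)
      (.ifEq (.var 8) (.var 11) .skip
        (.ifEq (.load 4 (.var 11)) (.add (.load 4 (.var 8)) (.load 3 (.var 11)))
          (.seq (.assign 9 (.var 11)) (.assign 10 (.load 5 (.var 11)))) .skip)) .skip) .skip)))

/-- One bid of the bidder in register `8`. -/
def bidOnce : Code :=
  .ifLt (.var 8) (.var 0) (.seq (.assign 1 (.var 8)) (.seq bfs (.seq findBest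
    (.ifLt (.var 9) (.var 0)
      (.seq (.assign 12 (.load 6 (.var 9))) (.seq (.store 6 (.var 9) (.var 8))
        (.seq (.store 5 (.var 9) (.add (.load 5 (.var 9)) (.lit 1))) (.assign 8 (.var 12)))))
      (.assign 8 (.var 0)))))) .skip

/-- Compute a maximum matching by an auction. -/
def auction : Code :=
  .seq (.forSize 11 (.seq (.store 5 (.var 11) (.lit 0)) (.store 6 (.var 11) (.var 0))))
    (.forSize 13 (.seq (.assign 8 (.var 13))
      (.seq (.forSize 14 (.forSize 15 bidOnce)) bidOnce)))

/-- The best price starts at n and only strictly cheaper vertices replace it. Finding none thus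
means that all neighbours cost at least n, which is the condition for withdrawing. -/
theorem findBest_spec {s : State} (h : HasInput G s) {x : Fin n} (hx : s.reg 8 = x)
    (hd : ∀ y : Fin n, s.arr 4 y = depth G y)
    (hA : ∀ v : Fin n, (G.Reachable x v → s.arr 3 v = G.dist x v) ∧
      (s.arr 3 v < n ↔ G.Reachable x v)) :
    ((findBest.eval s).reg 9 = n ∧
      ∀ y : Fin n, RootLT G (compRoot G) x y → n ≤ s.arr 5 y) ∨
    ∃ y : Fin n, (findBest.eval s).reg 9 = y ∧ RootLT G (compRoot G) x y ∧ s.arr 5 y < n ∧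
      ∀ y', RootLT G (compRoot G) x y' → s.arr 5 y ≤ s.arr 5 y' := by
  rw [findBest, Code.eval_seq, Code.eval_seq]
  set s₁ := (Code.assign 10 (.var 0)).eval ((Code.assign 9 (.var 0)).eval s) with hs₁
  have h₁ : HasInput G s₁ := (h.eval _ (by decide) (by decide)).eval _ (by decide) (by decide)
  have e9 : s₁.reg 9 = n := by
    simp [hs₁, Code.eval, Expr.eval, State.setReg_reg, h.size]
  have e10 : s₁.reg 10 = n := by
    simp [hs₁, Code.eval, Expr.eval, State.setReg_reg, h.size]
  have e8 : s₁.reg 8 = x := by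
    simp [hs₁, Code.eval, Expr.eval, State.setReg_reg, hx]
  have ea : s₁.arr = s.arr := rfl
  set p : Code := .ifLt (.load 5 (.var 11)) (.var 10) (.ifLt (.load 3 (.var 11)) (.var 0)
      (.ifEq (.var 8) (.var 11) .skip
        (.ifEq (.load 4 (.var 11)) (.add (.load 4 (.var 8)) (.load 3 (.var 11)))
          (.seq (.assign 9 (.var 11)) (.assign 10 (.load 5 (.var 11)))) .skip)) .skip) .skip with hp
  have key := Code.forSize_inv (x := 11) (p := p) s₁
    (fun k t => (t.reg 9 = n ∧ t.reg 10 = n ∧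
        ∀ y : Fin n, (y : ℕ) < k → RootLT G (compRoot G) x y → n ≤ s.arr 5 y) ∨
      ∃ y : Fin n, t.reg 9 = y ∧ t.reg 10 = s.arr 5 y ∧ RootLT G (compRoot G) x y ∧
        s.arr 5 y < n ∧
        ∀ y' : Fin n, (y' : ℕ) < k → RootLT G (compRoot G) x y' → s.arr 5 y ≤ s.arr 5 y')
    (by decide) ?_ ?_
  · rw [h₁.size] at key
    rcases key with ⟨k1, -, k3⟩ | ⟨y, k1, -, k3, k4, k5⟩
    · exact Or.inl ⟨k1, fun y => k3 y y.2⟩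
    · exact Or.inr ⟨y, k1, k3, k4, fun y' => k5 y' y'.2⟩
  · left
    refine ⟨?_, ?_, by simp⟩
    · simpa [State.setReg_reg] using e9
    · simpa [State.setReg_reg] using e10
  · intro k hk t htk htr hta hI
    rw [h₁.size] at hk
    have t0 : t.reg 0 = n := (htr 0 (by decide) (by decide)).trans h₁.size
    have t8 : t.reg 8 = x := (htr 8 (by decide) (by decide)).trans e8
    have a3 : t.arr 3 = s.arr 3 := (hta 3 (by decide)).trans (congrFun ea 3)
    have a4 : t.arr 4 = s.arr 4 := (hta 4 (by decide)).trans (congrFun ea 4)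
    have a5 : t.arr 5 = s.arr 5 := (hta 5 (by decide)).trans (congrFun ea 5)
    have hedge : RootLT G (compRoot G) x ⟨k, hk⟩ ↔ s.arr 3 k < n ∧ (x : ℕ) ≠ k ∧
        s.arr 4 k = s.arr 4 x + s.arr 3 k := by
      rw [rootLT_iff]
      have hk1 := hA ⟨k, hk⟩
      have hk2 := hd ⟨k, hk⟩
      simp only at hk1 hk2
      rw [hk1.2, hk2, hd, ne_eq, Fin.ext_iff]
      constructor
      · rintro ⟨h1, h2, h3⟩
        exact ⟨h2, h1, by rw [hk1.1 h2, h3]⟩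
      · rintro ⟨h1, h2, h3⟩
        exact ⟨h2, h1, by rw [← hk1.1 h1, h3]⟩
    by_cases hcheap : s.arr 5 k < t.reg 10
    · by_cases he : RootLT G (compRoot G) x ⟨k, hk⟩
      · obtain ⟨c1, c2, c3⟩ := hedge.mp he
        have hev : p.eval t = (t.setReg 9 k).setReg 10 (s.arr 5 k) := by
          simp [hp, Code.eval, Expr.eval, htk, t0, t8, a3, a4, a5, hcheap, c1, c2, c3,
            State.setReg_arr, State.setReg_reg]
        rw [hev]
        right
        refine ⟨⟨k, hk⟩, by simp [State.setReg_reg], by simp [State.setReg_reg], he, ?_, ?_⟩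
        · change s.arr 5 k < n
          rcases hI with ⟨-, h10, -⟩ | ⟨y, -, h10, -, hy, -⟩
          · omega
          · omega
        · intro y' hy' hxy'
          rcases Nat.lt_succ_iff_lt_or_eq.mp hy' with hy' | hy'
          · change s.arr 5 k ≤ s.arr 5 y'
            rcases hI with ⟨-, h10, h'⟩ | ⟨y, -, h10, -, hy, h'⟩
            · have := h' y' hy' hxy'
              omega
            · have := h' y' hy' hxy'
              omega
          · exact le_of_eq (by simp only [hy'])
      · have hev : p.eval t = t := by
          simp only [hp, Code.eval, Expr.eval, htk, t0, t8, a3, a4, a5, hcheap, if_true]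
          split_ifs with c1 c2 c3
          · rfl
          · exact absurd (hedge.mpr ⟨c1, c2, c3⟩) he
          · rfl
          · rfl
        have hne : ∀ y' : Fin n, (y' : ℕ) < k + 1 → RootLT G (compRoot G) x y' → (y' : ℕ) < k := by
          intro y' hy' hxy'
          rcases Nat.lt_succ_iff_lt_or_eq.mp hy' with hy' | hy'
          · exact hy'
          · have : y' = ⟨k, hk⟩ := Fin.ext hy'
            exact absurd (this ▸ hxy') he
        rw [hev]
        simp only [State.setReg_reg]
        rcases hI with ⟨h9, h10, h'⟩ | ⟨y, h9, h10, hy, hy2, h'⟩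
        · exact Or.inl ⟨by simpa using h9, by simpa using h10,
            fun y' hy' hxy' => h' y' (hne y' hy' hxy') hxy'⟩
        · exact Or.inr ⟨y, by simpa using h9, by simpa using h10, hy, hy2,
            fun y' hy' hxy' => h' y' (hne y' hy' hxy') hxy'⟩
    · have hev : p.eval t = t := by
        simp only [hp, Code.eval, Expr.eval, htk, a5, hcheap, if_false]
      rw [hev]
      simp only [State.setReg_reg]
      rcases hI with ⟨h9, h10, h'⟩ | ⟨y, h9, h10, hy, hy2, h'⟩
      · refine Or.inl ⟨by simpa using h9, by simpa using h10, fun y' hy' hxy' => ?_⟩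
        rcases Nat.lt_succ_iff_lt_or_eq.mp hy' with hy' | hy'
        · exact h' y' hy' hxy'
        · rw [hy']; omega
      · refine Or.inr ⟨y, by simpa using h9, by simpa using h10, hy, hy2, fun y' hy' hxy' => ?_⟩
        rcases Nat.lt_succ_iff_lt_or_eq.mp hy' with hy' | hy'
        · exact h' y' hy' hxy'
        · rw [hy']; omega

/-- The state represents the given state of the auction. -/
structure AuctionRep (G : SimpleGraph (Fin n)) (s : State) (price : Fin n → ℕ)
    (partner : Fin n → Option (Fin n)) (cur : Option (Fin n)) (D : Set (Fin n)) : Prop where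
  input : HasInput G s
  depth_eq : ∀ y : Fin n, s.arr 4 y = depth G y
  price_eq : ∀ y : Fin n, s.arr 5 y = price y
  partner_eq : ∀ y : Fin n, s.arr 6 y = encodeOpt (partner y)
  cur_eq : s.reg 8 = encodeOpt cur
  inv : AuctionInv (RootLT G (compRoot G)) price partner cur D

theorem AuctionRep.congr {s t : State} {price : Fin n → ℕ} {partner : Fin n → Option (Fin n)}
    {cur : Option (Fin n)} {D : Set (Fin n)} (h : AuctionRep G s price partner cur D)
    (h0 : t.reg 0 = s.reg 0) (h8 : t.reg 8 = s.reg 8) (ha : t.arr = s.arr) :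
    AuctionRep G t price partner cur D :=
  ⟨h.input.congr h0 (by rw [ha]), fun y => by rw [ha]; exact h.depth_eq y,
    fun y => by rw [ha]; exact h.price_eq y, fun y => by rw [ha]; exact h.partner_eq y,
    h8.trans h.cur_eq, h.inv⟩

/-- The sum of the prices is the progress measure: a call either ends the round or raises the sum by
one. Calls after the end of a round do nothing, so the calls can be put into loops of fixed length.
-/
theorem bidOnce_spec {s : State} {price : Fin n → ℕ} {partner : Fin n → Option (Fin n)}
    {cur : Option (Fin n)} {D : Set (Fin n)} (h : AuctionRep G s price partner cur D) :
    ∃ price' partner' cur', AuctionRep G (bidOnce.eval s) price' partner' cur' D ∧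
      (cur' = none ∨ ∑ y, price' y = ∑ y, price y + 1) ∧ (cur = none → cur' = none) := by
  rw [bidOnce, Code.eval]
  rcases cur with _ | x
  · rw [if_neg (by simp [Expr.eval, h.cur_eq, h.input.size, encodeOpt])]
    exact ⟨price, partner, none, h, Or.inl rfl, id⟩
  have hx : s.reg 8 = x := h.cur_eq
  rw [if_pos (by simp [Expr.eval, hx, h.input.size])]
  rw [Code.eval_seq, Code.eval_seq, Code.eval_seq]
  have h₁ : HasInput G ((Code.assign 1 (.var 8)).eval s) := h.input.eval _ (by decide) (by decide)
  have hspec := bfs_spec h₁ (src := x) (by simp [Code.eval, Expr.eval, State.setReg_reg, hx])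
  set u := bfs.eval ((Code.assign 1 (.var 8)).eval s) with hu
  have hui : HasInput G u := h₁.eval _ (by decide) (by decide)
  have u8 : u.reg 8 = x := by
    rw [hu, Code.eval_reg_of_notMem _ _ (by decide), Code.eval_reg_of_notMem _ _ (by decide), hx]
  have ua : ∀ j, j ≠ 3 → u.arr j = s.arr j := fun j hj => by
    rw [hu, Code.eval_arr_of_notMem _ _ (by simpa [bfs, relaxAll, relaxEdge, Code.whenAdj,
      Code.arrWrites] using hj), Code.eval_arr_of_notMem _ _ (by simp [Code.arrWrites])]
  have hbest := findBest_spec hui u8 (fun y => by rw [ua 4 (by decide)]; exact h.depth_eq y) hspec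
  simp only [ua 5 (by decide), h.price_eq] at hbest
  set w := findBest.eval u with hw
  have hwi : HasInput G w := hui.eval _ (by decide) (by decide)
  have w8 : w.reg 8 = x := (Code.eval_reg_of_notMem _ _ (by decide)).trans u8
  have wa : ∀ j, j ≠ 3 → w.arr j = s.arr j := fun j hj =>
    (Code.eval_arr_of_notMem _ _ (by simp [findBest, Code.arrWrites])).trans (ua j hj)
  rcases hbest with ⟨b9, hb⟩ | ⟨y, b9, hxy, hyn, hmin⟩
  · have hev : (Code.ifLt (.var 9) (.var 0)
      (.seq (.assign 12 (.load 6 (.var 9))) (.seq (.store 6 (.var 9) (.var 8))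
        (.seq (.store 5 (.var 9) (.add (.load 5 (.var 9)) (.lit 1))) (.assign 8 (.var 12)))))
      (.assign 8 (.var 0))).eval w = w.setReg 8 n := by
      simp [Code.eval, Expr.eval, b9, hwi.size]
    rw [hev]
    refine ⟨price, partner, none, ⟨hwi.congr (by simp [State.setReg_reg]) rfl, fun z => ?_,
      fun z => ?_, fun z => ?_, by simp [State.setReg_reg, encodeOpt],
      h.inv.withdraw (by simpa using hb)⟩, Or.inl rfl, fun _ => rfl⟩
    · rw [State.setReg_arr, wa 4 (by decide)]; exact h.depth_eq z
    · rw [State.setReg_arr, wa 5 (by decide)]; exact h.price_eq z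
    · rw [State.setReg_arr, wa 6 (by decide)]; exact h.partner_eq z
  · have w5 : w.arr 5 y = price y := by rw [wa 5 (by decide)]; exact h.price_eq y
    have w6 : w.arr 6 y = encodeOpt (partner y) := by
      rw [wa 6 (by decide)]; exact h.partner_eq y
    have hev : (Code.ifLt (.var 9) (.var 0)
      (.seq (.assign 12 (.load 6 (.var 9))) (.seq (.store 6 (.var 9) (.var 8))
        (.seq (.store 5 (.var 9) (.add (.load 5 (.var 9)) (.lit 1))) (.assign 8 (.var 12)))))
      (.assign 8 (.var 0))).eval w = (((w.setReg 12 (encodeOpt (partner y))).setArr 6 y x).setArr 5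
        y (price y + 1)).setReg 8 (encodeOpt (partner y)) := by
      simp [Code.eval, Expr.eval, b9, hwi.size, State.setReg_reg, State.setReg_arr,
        State.setArr_reg, State.setArr_arr, w6, w8, w5]
    rw [hev]
    refine ⟨_, _, _, ⟨hwi.congr ?_ ?_, fun z => ?_, fun z => ?_, fun z => ?_, ?_,
      h.inv.bid hxy (by simpa using hyn) hmin⟩, Or.inr ?_, by simp⟩
    · simp [State.setReg_reg, State.setArr_reg]
    · funext i
      simp [State.setReg_arr, State.setArr_arr]
    · simp only [State.setReg_arr, State.setArr_arr]
      rw [if_neg (by simp), if_neg (by simp), wa 4 (by decide)]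
      exact h.depth_eq z
    · simp only [State.setReg_arr, State.setArr_arr, true_and, Function.update_apply, Fin.ext_iff]
      rw [if_neg (show ¬ (5 = 6 ∧ (z : ℕ) = y) by simp), wa 5 (by decide), h.price_eq]
    · simp only [State.setReg_arr, State.setArr_arr, true_and, Function.update_apply, Fin.ext_iff]
      rw [if_neg (by simp), wa 6 (by decide), h.partner_eq]
      split_ifs <;> simp [encodeOpt]
    · simp [State.setReg_reg]
    · rw [Finset.sum_update_of_mem (Finset.mem_univ y)]
      have := Finset.sum_erase_add Finset.univ price (Finset.mem_univ y)
      rw [Finset.sdiff_singleton_eq_erase]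
      omega

theorem bidLoop_spec {s : State} {price : Fin n → ℕ} {partner : Fin n → Option (Fin n)}
    {cur : Option (Fin n)} {D : Set (Fin n)} (h : AuctionRep G s price partner cur D) :
    ∃ price' partner', AuctionRep G
      (bidOnce.eval ((Code.forSize 14 (.forSize 15 bidOnce)).eval s)) price' partner' none D := by
  have key := Code.forSize_inv (x := 14) (p := .forSize 15 bidOnce) s
    (fun k t => ∃ price partner cur, AuctionRep G t price partner cur D ∧
      (cur = none ∨ k * n ≤ ∑ y, price y)) (by decide) ?_ ?_
  · rw [h.input.size] at key
    obtain ⟨price₁, partner₁, cur₁, h₁, hs₁⟩ := key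
    rcases cur₁ with _ | x
    · obtain ⟨price₂, partner₂, cur₂, h₂, -, hs₂⟩ := bidOnce_spec h₁
      exact ⟨_, _, hs₂ rfl ▸ h₂⟩
    · obtain ⟨price₂, partner₂, cur₂, h₂, hs₂, -⟩ := bidOnce_spec h₁
      rcases hs₂ with rfl | hs₂
      · exact ⟨_, _, h₂⟩
      -- The first n² calls have raised the sum of the prices to at least n², its maximum, so the
      -- additional call cannot raise it further.
      · exfalso
        have h3 : n * n ≤ ∑ y, price₁ y := by simpa using hs₁
        have h4 : ∑ y, price₂ y ≤ ∑ _y : Fin n, n :=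
          Finset.sum_le_sum fun y _ => by simpa using h₂.inv.le_card y
        simp only [Finset.sum_const, Finset.card_univ, Fintype.card_fin, smul_eq_mul] at h4
        omega
  · exact ⟨price, partner, cur, h.congr (by simp [State.setReg_reg])
      (by simp [State.setReg_reg]) rfl, Or.inr (by simp)⟩
  · rintro k hk t htk htr hta ⟨price₁, partner₁, cur₁, h₁, hs₁⟩
    have key := Code.forSize_inv (x := 15) (p := bidOnce) t
      (fun j u => ∃ price partner cur, AuctionRep G u price partner cur D ∧
        (cur = none ∨ k * n + j ≤ ∑ y, price y)) (by decide) ?_ ?_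
    · rw [h₁.input.size] at key
      obtain ⟨price₂, partner₂, cur₂, h₂, hs₂⟩ := key
      exact ⟨price₂, partner₂, cur₂, h₂.congr (by simp [State.setReg_reg])
        (by simp [State.setReg_reg]) rfl, by rwa [Nat.succ_mul]⟩
    · exact ⟨price₁, partner₁, cur₁, h₁.congr (by simp [State.setReg_reg])
        (by simp [State.setReg_reg]) rfl, hs₁⟩
    · rintro j hj u huj hur hua ⟨price₂, partner₂, cur₂, h₂, hs₂⟩
      obtain ⟨price₃, partner₃, cur₃, h₃, hs₃, hn₃⟩ := bidOnce_spec h₂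
      refine ⟨price₃, partner₃, cur₃, h₃.congr (by simp [State.setReg_reg])
        (by simp [State.setReg_reg]) rfl, ?_⟩
      rcases hs₂ with h | h
      · exact Or.inl (hn₃ h)
      · exact hs₃.imp id fun h' => by omega

/-- At the end of the auction, array `6` holds the partners. -/
theorem auction_spec {s : State} (h : HasInput G s)
    (hd : ∀ y : Fin n, s.arr 4 y = depth G y) :
    ∃ price partner, (∀ y : Fin n, (auction.eval s).arr 6 y = encodeOpt (partner y)) ∧
      AuctionInv (RootLT G (compRoot G)) price partner none Set.univ := by
  rw [auction, Code.eval_seq]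
  set s₁ := (Code.forSize 11
    (.seq (.store 5 (.var 11) (.lit 0)) (.store 6 (.var 11) (.var 0)))).eval s with hs₁
  have h₁ : HasInput G s₁ := h.eval _ (by decide) (by decide)
  have hinit : ∀ y : Fin n, s₁.arr 5 y = 0 ∧ s₁.arr 6 y = n := by
    have key := Code.forSize_inv (x := 11)
      (p := .seq (.store 5 (.var 11) (.lit 0)) (.store 6 (.var 11) (.var 0))) s
      (fun k t => ∀ y : Fin n, (y : ℕ) < k → t.arr 5 y = 0 ∧ t.arr 6 y = n) (by decide)
      (by simp) ?_
    · exact fun y => key y (by rw [h.size]; exact y.2)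
    intro k hk t htk htr hta hI y hy
    have t0 : t.reg 0 = n := (htr 0 (by decide) (by decide)).trans h.size
    simp only [State.setReg_arr, Code.eval, Expr.eval, State.setArr_arr, State.setArr_reg, htk, t0,
      true_and]
    by_cases hyk : (y : ℕ) = k
    · simp [hyk]
    · simp [hyk, hI y (by omega)]
  have hd₁ : s₁.arr 4 = s.arr 4 := Code.eval_arr_of_notMem _ _ (by decide)
  have key := Code.forSize_inv (x := 13)
    (p := .seq (.assign 8 (.var 13)) (.seq (.forSize 14 (.forSize 15 bidOnce)) bidOnce)) s₁
    (fun k t => ∃ price partner, (∀ y : Fin n, t.arr 5 y = price y) ∧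
      (∀ y : Fin n, t.arr 6 y = encodeOpt (partner y)) ∧
      AuctionInv (RootLT G (compRoot G)) price partner none {x | (x : ℕ) < k}) (by decide) ?_ ?_
  · rw [h₁.size] at key
    obtain ⟨price, partner, -, k5, k7⟩ := key
    have huniv : {x : Fin n | (x : ℕ) < n} = Set.univ := by ext x; simp
    rw [huniv] at k7
    exact ⟨price, partner, k5, k7⟩
  · refine ⟨fun _ => 0, fun _ => none, fun y => (hinit y).1, fun y => (hinit y).2, ?_⟩
    have hempty : {x : Fin n | (x : ℕ) < 0} = ∅ := by ext x; simp
    rw [hempty]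
    exact AuctionInv.init
  · rintro k hk t htk htr hta ⟨price, partner, i5, i6, hinv⟩
    rw [h₁.size] at hk
    -- Round k admits vertex k to the auction; prices and partners are carried over from the earlier
    -- rounds.
    have hD : {x : Fin n | (x : ℕ) < k + 1} = insert ⟨k, hk⟩ {x : Fin n | (x : ℕ) < k} := by
      ext x
      simp only [Set.mem_ofPred_eq, Set.mem_insert_iff, Fin.ext_iff]
      omega
    have hrep : AuctionRep G ((Code.assign 8 (.var 13)).eval t) price partner (some ⟨k, hk⟩)
        {x : Fin n | (x : ℕ) < k + 1} := by
      refine ⟨h₁.congr ?_ (hta 0 (by decide)), fun y => ?_, i5, i6, ?_, ?_⟩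
      · simpa [Code.eval, State.setReg_reg] using htr 0 (by decide) (by decide)
      · rw [Code.eval, State.setReg_arr, hta 4 (by decide), hd₁]
        exact hd y
      · simp [Code.eval, Expr.eval, State.setReg_reg, htk, encodeOpt]
      · rw [hD]
        exact hinv.start (by simp)
    obtain ⟨price', partner', hrep'⟩ := bidLoop_spec hrep
    exact ⟨price', partner', hrep'.price_eq, hrep'.partner_eq, hrep'.inv⟩

end RAM

/-! ### Writing the paths -/

namespace RAM

/-- Append the vertex in register `21` to the current path; register `17` points to the end. -/
def emit : Code := .seq (.store 2 (.var 17) (.var 21)) (.assign 17 (.add (.var 17) (.lit 1)))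

/-- If the target in register `22` has been reached, replace it by its partner. -/
def retarget : Code :=
  .ifEq (.var 21) (.var 22)
    (.ifLt (.load 6 (.var 22)) (.var 0) (.assign 22 (.load 6 (.var 22))) .skip) .skip

/-- With the distances from the target in array `3`, find a neighbour of the vertex in register
`21` that is closer to the target. -/
def findNext : Code :=
  .forSize 24 (.whenAdj 21 24 (.ifEq (.add (.load 3 (.var 24)) (.lit 1)) (.load 3 (.var 21))
    (.assign 25 (.var 24)) .skip))

/-- Take one step towards the target. -/
def advance : Code :=
  .ifEq (.var 21) (.var 22) .skip
    (.seq (.assign 1 (.var 22)) (.seq bfs (.seq findNext (.seq (.assign 21 (.var 25)) emit))))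

/-- Write a path through the chain of the vertex in register `18`. -/
def tracePath : Code :=
  .seq (.assign 21 (.var 18)) (.seq (.assign 22 (.var 18)) (.seq emit
    (.seq (.forSize 23 (.seq retarget advance))
      (.seq (.assign 16 (.add (.var 16) (.lit 1))) (.store 1 (.var 16) (.var 17))))))

/-- Set register `19` to `1` if the vertex in register `18` is nobody's partner, else to `0`. -/
def testFree : Code :=
  .seq (.assign 19 (.lit 1))
    (.forSize 20 (.ifEq (.load 6 (.var 20)) (.var 18) (.assign 19 (.lit 0)) .skip))

/-- Write the paths through all chains; register `16` counts them. -/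
def writePaths : Code :=
  .seq (.assign 16 (.lit 0)) (.seq (.assign 17 (.lit 0)) (.seq (.store 1 (.lit 0) (.lit 0))
    (.forSize 18 (.seq testFree (.ifEq (.var 19) (.lit 1) tracePath .skip)))))

/-- The sequence in array `2` from the cell `a` to the cell before `b`. -/
def State.segment (s : State) (a b : ℕ) : List ℕ := (List.range' a (b - a)).map (s.arr 2)

theorem State.segment_congr {s t : State} {a b : ℕ}
    (h : ∀ q, a ≤ q → q < b → t.arr 2 q = s.arr 2 q) :
    t.segment a b = s.segment a b := by
  refine List.map_congr_left fun q hq => ?_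
  rw [List.mem_range'_1] at hq
  exact h q hq.1 (by omega)

theorem State.segment_succ (s : State) {a b : ℕ} (h : a ≤ b) :
    s.segment a (b + 1) = s.segment a b ++ [s.arr 2 b] := by
  rw [State.segment, State.segment, Nat.succ_sub h, List.range'_concat]
  simp [Nat.add_sub_cancel' h]

variable {n : ℕ} {G : SimpleGraph (Fin n)}

/-- `z` is below `x` in a chain. -/
def ChainBelow (partner : Fin n → Option (Fin n)) : Fin n → Fin n → Prop :=
  Relation.ReflTransGen fun a b => partner a = some b

/-- The state describes the walk `w` from `x` to the current vertex, which covers the part of the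
chain above the target. -/
structure WalkState (G : SimpleGraph (Fin n)) (partner : Fin n → Option (Fin n)) (x : Fin n)
    (p₀ : ℕ) (s : State) (cur tgt : Fin n) (w : G.Walk x cur) : Prop where
  input : HasInput G s
  partner_eq : ∀ y : Fin n, s.arr 6 y = encodeOpt (partner y)
  cur_eq : s.reg 21 = cur
  tgt_eq : s.reg 22 = tgt
  le_pos : p₀ ≤ s.reg 17
  segment_eq : s.segment p₀ (s.reg 17) = w.support.map fun v : Fin n => (v : ℕ)
  depth_eq : depth G x = depth G cur + w.length
  reachable : G.Reachable tgt cur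
  depth_cur : depth G cur = depth G tgt + G.dist tgt cur
  covers : ∀ z, ChainBelow partner x z → z ∈ w.support ∨ ChainBelow partner tgt z

variable {partner : Fin n → Option (Fin n)} {x : Fin n} {p₀ : ℕ} {s : State}

theorem WalkState.setReg {cur tgt : Fin n} {w : G.Walk x cur}
    (h : WalkState G partner x p₀ s cur tgt w) {r : ℕ} (hr : r ∉ [0, 17, 21, 22]) (v : ℕ) :
    WalkState G partner x p₀ (s.setReg r v) cur tgt w := by
  simp only [List.mem_cons, List.not_mem_nil, or_false, not_or] at hr
  have e : ∀ q, q ≠ r → (s.setReg r v).reg q = s.reg q := fun q hq =>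
    State.setReg_reg_of_ne _ _ hq
  refine ⟨h.input.congr (e 0 (Ne.symm hr.1)) rfl, h.partner_eq, ?_, ?_, ?_, ?_, h.depth_eq,
    h.reachable, h.depth_cur, h.covers⟩
  · rw [e 21 (Ne.symm hr.2.2.1)]; exact h.cur_eq
  · rw [e 22 (Ne.symm hr.2.2.2)]; exact h.tgt_eq
  · rw [e 17 (Ne.symm hr.2.1)]; exact h.le_pos
  · rw [e 17 (Ne.symm hr.2.1)]; exact h.segment_eq

/-- A partner is a different vertex, so after this step the walk stands on its target only if the
chain has ended there. -/
theorem retarget_spec (hp : ∀ x y, partner y = some x → RootLT G (compRoot G) x y)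
    {cur tgt : Fin n} {w : G.Walk x cur} (h : WalkState G partner x p₀ s cur tgt w) :
    ∃ tgt', WalkState G partner x p₀ (retarget.eval s) cur tgt' w ∧
      (cur = tgt' ↔ cur = tgt ∧ partner tgt = none) := by
  simp only [retarget, Code.eval, Expr.eval, h.cur_eq, h.tgt_eq, h.partner_eq, h.input.size,
    encodeOpt_lt]
  by_cases hct : cur = tgt
  · subst hct
    rw [if_pos rfl]
    by_cases hn : partner cur = none
    · rw [if_neg (by simpa using hn)]
      exact ⟨cur, h, fun _ => ⟨rfl, hn⟩, fun _ => rfl⟩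
    · rw [if_pos hn]
      obtain ⟨t, ht⟩ := Option.ne_none_iff_exists'.mp hn
      obtain ⟨h1, h2, h3⟩ := rootLT_iff.mp (hp _ _ ht)
      refine ⟨t, ⟨h.input.congr ?_ rfl, h.partner_eq, ?_, ?_, ?_, ?_, h.depth_eq, h2, h3, ?_⟩,
        fun h' => absurd h'.symm h1, fun h' => absurd h'.2 hn⟩
      · simp [State.setReg_reg]
      · simpa [State.setReg_reg] using h.cur_eq
      · simp [State.setReg_reg, ht, encodeOpt]
      · simpa [State.setReg_reg] using h.le_pos
      · rw [State.setReg_reg_of_ne _ _ (by decide)]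
        exact h.segment_eq
      · intro z hz
        rcases h.covers z hz with h' | h'
        · exact Or.inl h'
        · rcases Relation.ReflTransGen.cases_head h' with rfl | ⟨c, hc, hcz⟩
          · exact Or.inl (SimpleGraph.Walk.end_mem_support w)
          · rw [ht] at hc
            cases hc
            exact Or.inr hcz
  · rw [if_neg (by simpa [Fin.ext_iff] using hct)]
    exact ⟨tgt, h, fun h' => absurd h' hct, fun h' => absurd h'.1 hct⟩

theorem findNext_spec {cur tgt : Fin n} (h : HasInput G s) (hcur : s.reg 21 = cur)
    (hA : ∀ v : Fin n, (G.Reachable tgt v → s.arr 3 v = G.dist tgt v) ∧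
      (s.arr 3 v < n ↔ G.Reachable tgt v))
    (hr : G.Reachable tgt cur) (hne : cur ≠ tgt) :
    ∃ y : Fin n, (findNext.eval s).reg 25 = y ∧ G.Adj cur y ∧
      G.dist tgt y + 1 = G.dist tgt cur := by
  classical
  have key := Code.forSize_inv (x := 24) (p := .whenAdj 21 24 (.ifEq
      (.add (.load 3 (.var 24)) (.lit 1)) (.load 3 (.var 21)) (.assign 25 (.var 24)) .skip)) s
    -- An implication, because register `25` is not initialized and holds a meaningful value only
    -- after the first hit; later hits overwrite it.
    (fun k t => (∃ y : Fin n, (y : ℕ) < k ∧ G.Adj cur y ∧ G.dist tgt y + 1 = G.dist tgt cur) →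
      ∃ y : Fin n, t.reg 25 = y ∧ G.Adj cur y ∧ G.dist tgt y + 1 = G.dist tgt cur) (by decide)
    (by simp) ?_
  · refine key ?_
    obtain ⟨f, hf, hf0, hfl⟩ := hr.exists_isGeodesicSeq
    have hpos := hr.pos_dist_of_ne hne.symm
    obtain ⟨m, hm⟩ : ∃ m, G.dist tgt cur = m + 1 := ⟨_, (Nat.succ_pred_eq_of_pos hpos).symm⟩
    rw [hm] at hf hfl
    refine ⟨f m, by rw [h.size]; exact (f m).2, ?_, ?_⟩
    · have := hf.adj m (by omega)
      rw [hfl] at this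
      exact this.symm
    · have := hf.dist_eq 0 m (by omega) (by omega)
      rw [hf0] at this
      omega
  · rintro k hk t htk htr hta hI ⟨y, hyk, hadj, hy⟩
    rw [h.size] at hk
    have ht : HasInput G t := h.congr (htr 0 (by decide) (by decide)) (hta 0 (by decide))
    have ht21 : t.reg 21 = cur := (htr 21 (by decide) (by decide)).trans hcur
    have ha3 : t.arr 3 = s.arr 3 := hta 3 (by decide)
    rw [Code.whenAdj_eval ht (b := ⟨k, hk⟩) ht21 htk]
    have hk' := (hA ⟨k, hk⟩).1
    have hAc := (hA cur).1 hr
    simp only [Code.eval, Expr.eval, htk, ht21, ha3, hAc]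
    by_cases hgood : G.Adj cur ⟨k, hk⟩ ∧ G.dist tgt ⟨k, hk⟩ + 1 = G.dist tgt cur
    · have hrk := hk' (hr.trans hgood.1.reachable)
      simp only at hrk
      rw [if_pos hgood.1, if_pos (by rw [hrk]; exact hgood.2)]
      exact ⟨⟨k, hk⟩, by simp [State.setReg_reg], hgood⟩
    · have hprev : ∃ y : Fin n, t.reg 25 = y ∧ G.Adj cur y ∧
          G.dist tgt y + 1 = G.dist tgt cur := by
        refine hI ⟨y, ?_, hadj, hy⟩
        rcases Nat.lt_succ_iff_lt_or_eq.mp hyk with h' | h'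
        · exact h'
        · have : y = ⟨k, hk⟩ := Fin.ext h'
          subst this
          exact absurd ⟨hadj, hy⟩ hgood
      split_ifs with c1 c2
      · have hrk := hk' (hr.trans c1.reachable)
        simp only at hrk
        exact absurd ⟨c1, by rw [← hrk]; exact c2⟩ hgood
      · simpa [State.setReg_reg] using hprev
      · simpa [State.setReg_reg] using hprev

/-- A neighbour closer to the target is also exactly one closer to the root: the target lies on a
shortest path from the root to the current vertex, and depths of adjacent vertices differ by at most
one. -/
theorem advance_spec {cur tgt : Fin n} {w : G.Walk x cur}
    (h : WalkState G partner x p₀ s cur tgt w) :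
    (∀ q < p₀, (advance.eval s).arr 2 q = s.arr 2 q) ∧
    ∃ cur', ∃ w' : G.Walk x cur', WalkState G partner x p₀ (advance.eval s) cur' tgt w' ∧
      (cur ≠ tgt → w'.length = w.length + 1) ∧ (cur = tgt → cur' = tgt) := by
  by_cases hct : cur = tgt
  · have hev : advance.eval s = s := by
      simp [advance, Code.eval, Expr.eval, h.cur_eq, h.tgt_eq, hct]
    rw [hev]
    exact ⟨fun _ _ => rfl, cur, w, h, fun h' => absurd hct h', id⟩
  have hev : advance.eval s = (Code.seq (.assign 21 (.var 25)) emit).eval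
      (findNext.eval (bfs.eval ((Code.assign 1 (.var 22)).eval s))) := by
    refine if_neg ?_
    simpa [Expr.eval, h.cur_eq, h.tgt_eq, Fin.ext_iff] using hct
  have h₁ : HasInput G ((Code.assign 1 (.var 22)).eval s) := h.input.eval _ (by decide) (by decide)
  have hspec := bfs_spec h₁ (src := tgt)
    (by simp [Code.eval, Expr.eval, State.setReg_reg, h.tgt_eq])
  set u := bfs.eval ((Code.assign 1 (.var 22)).eval s) with hu
  have hui : HasInput G u := h₁.eval _ (by decide) (by decide)
  have ur : ∀ r, r ∉ bfs.writes → r ≠ 1 → u.reg r = s.reg r := fun r hr h1 => by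
    rw [hu, Code.eval_reg_of_notMem _ _ hr,
      Code.eval_reg_of_notMem _ _ (by simpa [Code.writes] using h1)]
  have ua : ∀ j, j ∉ bfs.arrWrites → u.arr j = s.arr j := fun j hj => by
    rw [hu, Code.eval_arr_of_notMem _ _ hj, Code.eval_arr_of_notMem _ _ (by simp [Code.arrWrites])]
  obtain ⟨y, hy, hadj, hdist⟩ := findNext_spec hui
    ((ur 21 (by decide) (by decide)).trans h.cur_eq) hspec h.reachable hct
  set v := findNext.eval u with hv
  have hvi : HasInput G v := hui.eval _ (by decide) (by decide)
  have v17 : v.reg 17 = s.reg 17 :=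
    (Code.eval_reg_of_notMem _ _ (by decide)).trans (ur 17 (by decide) (by decide))
  have v22 : v.reg 22 = tgt :=
    ((Code.eval_reg_of_notMem _ _ (by decide)).trans (ur 22 (by decide) (by decide))).trans h.tgt_eq
  have v2 : v.arr 2 = s.arr 2 := (Code.eval_arr_of_notMem _ _ (by decide)).trans (ua 2 (by decide))
  have v6 : v.arr 6 = s.arr 6 := (Code.eval_arr_of_notMem _ _ (by decide)).trans (ua 6 (by decide))
  have hev' : advance.eval s =
      ((v.setReg 21 y).setArr 2 (s.reg 17) y).setReg 17 (s.reg 17 + 1) := by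
    rw [hev]
    simp [emit, Code.eval, Expr.eval, State.setReg_reg, State.setArr_reg, hy, v17]
  have hlow : ∀ q < s.reg 17, (advance.eval s).arr 2 q = s.arr 2 q := by
    intro q hq
    rw [hev', State.setReg_arr, State.setArr_arr, if_neg (by omega), State.setReg_arr, v2]
  have h17 : (advance.eval s).reg 17 = s.reg 17 + 1 := by simp [hev', State.setReg_reg]
  have hrt : G.Reachable tgt y := h.reachable.trans hadj.reachable
  have hdy := depth_le_add_dist hrt
  have hdc := depth_le_add_dist hadj.symm.reachable
  rw [SimpleGraph.dist_eq_one_iff_adj.mpr hadj.symm] at hdc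
  have hcy := h.depth_cur
  refine ⟨fun q hq => hlow q (hq.trans_le h.le_pos), y, w.concat hadj,
    ⟨hvi.congr ?_ ?_, fun z => ?_, ?_, ?_, ?_, ?_, ?_, hrt, by omega, ?_⟩,
    fun _ => SimpleGraph.Walk.length_concat _ _, fun h' => absurd h' hct⟩
  · simp [hev', State.setReg_reg, State.setArr_reg]
  · funext i
    simp [hev', State.setReg_arr, State.setArr_arr]
  · rw [← h.partner_eq z, ← v6]
    simp [hev', State.setReg_arr, State.setArr_arr]
  · simp [hev', State.setReg_reg, State.setArr_reg]
  · simp [hev', State.setReg_reg, State.setArr_reg, v22]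
  · rw [h17]
    exact h.le_pos.trans (Nat.le_succ _)
  · rw [h17, State.segment_succ _ h.le_pos,
      State.segment_congr (s := s) fun q _ hq => hlow q hq, h.segment_eq]
    simp [hev', State.setReg_arr, State.setArr_arr, SimpleGraph.Walk.support_concat]
  · rw [SimpleGraph.Walk.length_concat, h.depth_eq]
    omega
  · intro z hz
    rcases h.covers z hz with h' | h'
    · exact Or.inl (by simp [SimpleGraph.Walk.support_concat, h'])
    · exact Or.inr h'

/-- The difference of the depths is a lower bound for the distance, so a walk that loses depth at
every step is shortest. -/
theorem isIsometricPath_support_of_depth {cur : Fin n} (w : G.Walk x cur)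
    (h : depth G x = depth G cur + w.length) : IsIsometricPath G w.support := by
  have h1 := depth_le_add_dist w.reachable.symm
  have h2 := SimpleGraph.dist_le w
  rw [SimpleGraph.dist_comm] at h1
  have hw : w.length = G.dist x cur := by omega
  exact ⟨x, cur, w, w.isPath_of_length_eq_dist hw, hw, rfl⟩

theorem tracePath_spec (h : HasInput G s)
    (hpart : ∀ y : Fin n, s.arr 6 y = encodeOpt (partner y))
    (hp : ∀ x y, partner y = some x → RootLT G (compRoot G) x y) (hx : s.reg 18 = x) :
    ∃ l : List (Fin n), IsIsometricPath G l ∧ (∀ z, ChainBelow partner x z → z ∈ l) ∧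
      (tracePath.eval s).reg 16 = s.reg 16 + 1 ∧ s.reg 17 ≤ (tracePath.eval s).reg 17 ∧
      (∀ i, (tracePath.eval s).arr 1 i =
        if i = s.reg 16 + 1 then (tracePath.eval s).reg 17 else s.arr 1 i) ∧
      (∀ q < s.reg 17, (tracePath.eval s).arr 2 q = s.arr 2 q) ∧
      (tracePath.eval s).segment (s.reg 17) ((tracePath.eval s).reg 17) =
        l.map fun v : Fin n => (v : ℕ) := by
  set s₁ := emit.eval ((Code.assign 22 (.var 18)).eval ((Code.assign 21 (.var 18)).eval s)) with hs₁
  have hs₁' : s₁ = (((s.setReg 21 x).setReg 22 x).setArr 2 (s.reg 17) x).setReg 17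
      (s.reg 17 + 1) := by
    simp [hs₁, emit, Code.eval, Expr.eval, State.setReg_reg, State.setArr_reg, hx]
  set s₂ := (Code.forSize 23 (.seq retarget advance)).eval s₁ with hs₂
  have hev : tracePath.eval s = (s₂.setReg 16 (s₂.reg 16 + 1)).setArr 1 (s₂.reg 16 + 1)
      (s₂.reg 17) := by
    simp [tracePath, Code.eval_seq, ← hs₁, ← hs₂]
    simp [Code.eval, Expr.eval, State.setReg_reg]
  have low₁ : ∀ q < s.reg 17, s₁.arr 2 q = s.arr 2 q := fun q hq => by
    rw [hs₁', State.setReg_arr, State.setArr_arr, if_neg (by omega)]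
    rfl
  have hw₁ : WalkState G partner x (s.reg 17) s₁ x x SimpleGraph.Walk.nil := by
    refine ⟨h.congr ?_ ?_, fun z => ?_, ?_, ?_, ?_, ?_, by simp, SimpleGraph.Reachable.rfl,
      by simp, fun z hz => Or.inr hz⟩
    · simp [hs₁', State.setReg_reg, State.setArr_reg]
    · funext i
      simp [hs₁', State.setReg_arr, State.setArr_arr]
    · rw [← hpart z]
      simp [hs₁', State.setReg_arr, State.setArr_arr]
    · simp [hs₁', State.setReg_reg, State.setArr_reg]
    · simp [hs₁', State.setReg_reg, State.setArr_reg]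
    · simp [hs₁', State.setReg_reg]
    · have h17 : s₁.reg 17 = s.reg 17 + 1 := by simp [hs₁', State.setReg_reg]
      rw [h17, State.segment_succ _ le_rfl]
      simp [hs₁', State.segment, State.setReg_arr, State.setArr_arr]
  -- Each round lengthens the walk unless the chain is finished. The length is at most the depth of
  -- x, which is less than n, so after n rounds only the second alternative is left.
  have key := Code.forSize_inv (x := 23) (p := .seq retarget advance) s₁
    (fun k t => (∀ q < s.reg 17, t.arr 2 q = s.arr 2 q) ∧
      ∃ cur tgt, ∃ w : G.Walk x cur, WalkState G partner x (s.reg 17) t cur tgt w ∧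
        (k ≤ w.length ∨ cur = tgt ∧ partner tgt = none)) (by decide) ?_ ?_
  · rw [hw₁.input.size, ← hs₂] at key
    obtain ⟨low₂, cur, tgt, w, hw, hfin⟩ := key
    have hd := hw.depth_eq
    have hdx := depth_lt G x
    obtain ⟨hct, hnone⟩ := hfin.resolve_left (by omega)
    subst hct
    have e16 : s₂.reg 16 = s.reg 16 := by
      rw [hs₂, Code.eval_reg_of_notMem _ _ (by decide)]
      simp [hs₁', State.setReg_reg, State.setArr_reg]
    have e1 : s₂.arr 1 = s.arr 1 := by
      rw [hs₂, Code.eval_arr_of_notMem _ _ (by decide)]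
      funext i
      simp [hs₁', State.setReg_arr, State.setArr_arr]
    have r17 : (tracePath.eval s).reg 17 = s₂.reg 17 := by
      simp [hev, State.setReg_reg, State.setArr_reg]
    have a2 : (tracePath.eval s).arr 2 = s₂.arr 2 := by
      funext q
      simp [hev, State.setReg_arr, State.setArr_arr]
    refine ⟨w.support, isIsometricPath_support_of_depth w hd, fun z hz => ?_, ?_, ?_, fun i => ?_,
      fun q hq => ?_, ?_⟩
    · rcases hw.covers z hz with h' | h'
      · exact h'
      · rcases Relation.ReflTransGen.cases_head h' with rfl | ⟨c, hc, -⟩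
        · exact SimpleGraph.Walk.end_mem_support w
        · rw [hnone] at hc
          cases hc
    · simp [hev, State.setReg_reg, State.setArr_reg, e16]
    · rw [r17]; exact hw.le_pos
    · rw [r17, hev, State.setArr_arr, State.setReg_arr, e16, e1]
      simp
    · rw [a2]; exact low₂ q hq
    · rw [r17, ← hw.segment_eq]
      exact State.segment_congr fun q _ _ => by rw [a2]
  · refine ⟨low₁, x, x, SimpleGraph.Walk.nil, hw₁.setReg (by decide) _,
      Or.inl (Nat.zero_le _)⟩
  · rintro k hk t htk htr hta ⟨low, cur, tgt, w, hw, hfin⟩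
    obtain ⟨tgt', hw', hsame⟩ := retarget_spec hp hw
    obtain ⟨low', cur', w', hw'', hlen, hsame'⟩ := advance_spec hw'
    rw [Code.eval_seq]
    set v := advance.eval (retarget.eval t) with hv
    refine ⟨fun q hq => ?_, cur', tgt', w', ?_, ?_⟩
    · rw [State.setReg_arr, low' q hq, Code.eval_arr_of_notMem _ _ (by decide)]
      exact low q hq
    · exact hw''.setReg (by decide) _
    · by_cases hc : cur = tgt'
      · obtain ⟨h1, h2⟩ := hsame.mp hc
        right
        refine ⟨hsame' hc, ?_⟩
        rwa [← hc, h1]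
      · left
        have := hlen hc
        rcases hfin with h1 | ⟨h1, h2⟩
        · omega
        · exact absurd (hsame.mpr ⟨h1, h2⟩) hc

end RAM

/-! ### One path for each chain, and the complete algorithm -/

namespace RAM

variable {n : ℕ} {G : SimpleGraph (Fin n)} {partner : Fin n → Option (Fin n)} {s : State}

theorem testFree_spec (h : s.reg 0 = n)
    (hpart : ∀ y : Fin n, s.arr 6 y = encodeOpt (partner y)) {x : Fin n} (hx : s.reg 18 = x) :
    (testFree.eval s).reg 19 = 1 ↔ ∀ y, partner y ≠ some x := by
  set s₁ := (Code.assign 19 (.lit 1)).eval s with hs₁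
  have key := Code.forSize_inv (x := 20)
    (p := .ifEq (.load 6 (.var 20)) (.var 18) (.assign 19 (.lit 0)) .skip) s₁
    (fun k t => (t.reg 19 = 1 ↔ ∀ y : Fin n, (y : ℕ) < k → partner y ≠ some x)) (by decide)
    ?_ ?_
  · have h0 : s₁.reg 0 = n := by simpa [hs₁, Code.eval, State.setReg_reg] using h
    rw [h0] at key
    exact key.trans ⟨fun h y => h y y.2, fun h y _ => h y⟩
  · simp [hs₁, Code.eval, Expr.eval, State.setReg_reg]
  · intro k hk t htk htr hta hI
    have h0 : s₁.reg 0 = n := by simpa [hs₁, Code.eval, State.setReg_reg] using h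
    rw [h0] at hk
    have t18 : t.reg 18 = x := by
      rw [htr 18 (by decide) (by decide)]
      simpa [hs₁, Code.eval, State.setReg_reg] using hx
    have t6 : t.arr 6 k = encodeOpt (partner ⟨k, hk⟩) := by
      rw [hta 6 (by decide)]
      exact hpart ⟨k, hk⟩
    simp only [Code.eval, Expr.eval, htk, t18, t6, encodeOpt_eq_coe]
    split_ifs with hc
    · simp only [State.setReg_reg]
      refine ⟨fun h => by simp at h, fun h => absurd hc (h ⟨k, hk⟩ (by simp))⟩
    · rw [State.setReg_reg_of_ne _ _ (by decide), hI]
      refine ⟨fun h y hy => ?_, fun h y hy => h y (by omega)⟩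
      rcases Nat.lt_succ_iff_lt_or_eq.mp hy with hy | hy
      · exact h y hy
      · have : y = ⟨k, hk⟩ := Fin.ext hy
        rwa [this]

/-- The state describes the paths `P`, one through the chain of each free vertex below `k`. -/
structure PathsWritten (G : SimpleGraph (Fin n)) (partner : Fin n → Option (Fin n)) (k : ℕ)
    (s : State) (P : List (List (Fin n))) (F : Finset (Fin n)) : Prop where
  count : s.reg 16 = P.length
  last : s.arr 1 (s.reg 16) = s.reg 17
  le_pos : ∀ i ≤ s.reg 16, s.arr 1 i ≤ s.reg 17
  segments : (List.range (s.reg 16)).map (fun i => s.segment (s.arr 1 i) (s.arr 1 (i + 1))) =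
    P.map fun l => l.map fun v : Fin n => (v : ℕ)
  isometric : ∀ l ∈ P, IsIsometricPath G l
  covers : ∀ x : Fin n, (x : ℕ) < k → (∀ y, partner y ≠ some x) →
    ∃ l ∈ P, ∀ z, ChainBelow partner x z → z ∈ l
  free : ∀ x ∈ F, (x : ℕ) < k ∧ ∀ y, partner y ≠ some x
  card_free : F.card = P.length

/-- F collects the vertices that start a path. Its cardinality equals the number of paths, which
links the output to the bound from the auction. -/
theorem writePaths_spec (h : HasInput G s)
    (hpart : ∀ y : Fin n, s.arr 6 y = encodeOpt (partner y))
    (hp : ∀ x y, partner y = some x → RootLT G (compRoot G) x y) :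
    ∃ P F, PathsWritten G partner n (writePaths.eval s) P F := by
  set s₁ := (Code.store 1 (.lit 0) (.lit 0)).eval ((Code.assign 17 (.lit 0)).eval
    ((Code.assign 16 (.lit 0)).eval s)) with hs₁
  have key := Code.forSize_inv (x := 18)
    (p := .seq testFree (.ifEq (.var 19) (.lit 1) tracePath .skip)) s₁
    (fun k t => ∃ P F, PathsWritten G partner k t P F) (by decide) ?_ ?_
  · have h0 : s₁.reg 0 = n := by
      simpa [hs₁, Code.eval, State.setReg_reg, State.setArr_reg] using h.size
    rw [h0] at key
    exact key
  · have e16 : (s₁.setReg 18 0).reg 16 = 0 := by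
      simp [hs₁, Code.eval, Expr.eval, State.setReg_reg, State.setArr_reg]
    have e17 : (s₁.setReg 18 0).reg 17 = 0 := by
      simp [hs₁, Code.eval, Expr.eval, State.setReg_reg, State.setArr_reg]
    have e1 : (s₁.setReg 18 0).arr 1 0 = 0 := by
      simp [hs₁, Code.eval, Expr.eval, State.setReg_arr, State.setArr_arr]
    refine ⟨[], ∅, ⟨e16, by rw [e16, e17, e1], fun i hi => ?_, by simp [e16], by simp, by simp,
      by simp, rfl⟩⟩
    rw [e16] at hi
    rw [Nat.le_zero.mp hi, e1]
    exact Nat.zero_le _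
  · rintro k hk t htk htr hta ⟨P, F, hPF⟩
    have hs₁i : HasInput G s₁ :=
      ((h.eval _ (by decide) (by decide)).eval _ (by decide) (by decide)).eval _ (by decide)
        (by decide)
    rw [hs₁i.size] at hk
    have hti : HasInput G t := hs₁i.congr (htr 0 (by decide) (by decide)) (hta 0 (by decide))
    have t6 : ∀ y : Fin n, t.arr 6 y = encodeOpt (partner y) := fun y => by
      rw [hta 6 (by decide), ← hpart y, hs₁, Code.eval_arr_of_notMem _ _ (by decide),
        Code.eval_arr_of_notMem _ _ (by decide), Code.eval_arr_of_notMem _ _ (by decide)]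
    have hfree := testFree_spec (x := ⟨k, hk⟩) hti.size t6 htk
    rw [Code.eval_seq]
    set u := testFree.eval t with hu
    have ua : u.arr = t.arr := by
      funext j
      exact Code.eval_arr_of_notMem _ _ (by simp [testFree, Code.arrWrites])
    have u16 : u.reg 16 = t.reg 16 := Code.eval_reg_of_notMem _ _ (by decide)
    have u17 : u.reg 17 = t.reg 17 := Code.eval_reg_of_notMem _ _ (by decide)
    have u18 : u.reg 18 = k := (Code.eval_reg_of_notMem _ _ (by decide)).trans htk
    have hui : HasInput G u := hti.eval _ (by decide) (by decide)
    have useg : ∀ a b, u.segment a b = t.segment a b := fun a b =>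
      State.segment_congr fun q _ _ => by rw [ua]
    by_cases hc : u.reg 19 = 1
    · rw [show (Code.ifEq (.var 19) (.lit 1) tracePath .skip).eval u = tracePath.eval u from
        if_pos hc]
      have hf := hfree.mp hc
      obtain ⟨l, l1, l2, l3, l4, l5, l6, l7⟩ := tracePath_spec (x := ⟨k, hk⟩) hui
        (fun y => by rw [ua]; exact t6 y) hp u18
      set v := tracePath.eval u with hv
      have e16 : (v.setReg 18 (k + 1)).reg 16 = t.reg 16 + 1 := by
        rw [State.setReg_reg_of_ne _ _ (by decide), l3, u16]
      have e17 : (v.setReg 18 (k + 1)).reg 17 = v.reg 17 :=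
        State.setReg_reg_of_ne _ _ (by decide)
      rw [u17] at l4 l6 l7
      rw [u16, ua] at l5
      rw [ua] at l6
      refine ⟨P ++ [l], insert ⟨k, hk⟩ F, ⟨?_, ?_, ?_, ?_, ?_, ?_, ?_, ?_⟩⟩
      · rw [e16, hPF.count]
        simp
      · rw [e16, e17, State.setReg_arr, l5, if_pos rfl]
      · intro i hi
        rw [e16] at hi
        rw [e17, State.setReg_arr, l5]
        split_ifs with hi'
        · rfl
        · exact (hPF.le_pos i (by omega)).trans l4
      · rw [e16, List.range_succ, List.map_append, List.map_append, ← hPF.segments]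
        congr 1
        · refine List.map_congr_left fun i hi => ?_
          rw [List.mem_range] at hi
          rw [State.setReg_arr, l5, l5, if_neg (by omega), if_neg (by omega)]
          refine State.segment_congr fun q _ hq => l6 q ?_
          have := hPF.le_pos (i + 1) (by omega)
          omega
        · simp only [List.map_cons, List.map_nil]
          rw [State.setReg_arr, l5, l5, if_neg (by omega), if_pos rfl, hPF.last, ← l7]
          congr 1
      · intro l' hl'
        rcases List.mem_append.mp hl' with hl' | hl'
        · exact hPF.isometric l' hl'
        · rwa [List.mem_singleton.mp hl']
      · intro x hx hxf
        rcases Nat.lt_succ_iff_lt_or_eq.mp hx with hx | hx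
        · obtain ⟨l', hl', hz⟩ := hPF.covers x hx hxf
          exact ⟨l', List.mem_append_left _ hl', hz⟩
        · have : x = ⟨k, hk⟩ := Fin.ext hx
          subst this
          exact ⟨l, by simp, l2⟩
      · intro x hx
        rcases Finset.mem_insert.mp hx with rfl | hx
        · exact ⟨Nat.lt_succ_self k, hf⟩
        · exact ⟨(hPF.free x hx).1.trans (Nat.lt_succ_self k), (hPF.free x hx).2⟩
      · rw [Finset.card_insert_of_notMem fun hx => absurd (hPF.free _ hx).1 (lt_irrefl k),
          hPF.card_free]
        simp
    · rw [show (Code.ifEq (.var 19) (.lit 1) tracePath .skip).eval u = u from if_neg hc]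
      have e16 : (u.setReg 18 (k + 1)).reg 16 = t.reg 16 := by
        rw [State.setReg_reg_of_ne _ _ (by decide), u16]
      have e17 : (u.setReg 18 (k + 1)).reg 17 = t.reg 17 := by
        rw [State.setReg_reg_of_ne _ _ (by decide), u17]
      refine ⟨P, F, ⟨?_, ?_, ?_, ?_, hPF.isometric, ?_, ?_, hPF.card_free⟩⟩
      · rw [e16, hPF.count]
      · rw [e16, e17, State.setReg_arr, ua, hPF.last]
      · rw [e16, e17, State.setReg_arr, ua]
        exact hPF.le_pos
      · rw [e16, State.setReg_arr, ua, ← hPF.segments]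
        exact List.map_congr_left fun i _ => useg _ _
      · intro x hx hxf
        rcases Nat.lt_succ_iff_lt_or_eq.mp hx with hx | hx
        · exact hPF.covers x hx hxf
        · have : x = ⟨k, hk⟩ := Fin.ext hx
          subst this
          exact absurd (hfree.mpr hxf) hc
      · exact fun x hx => ⟨(hPF.free x hx).1.trans (Nat.lt_succ_self k), (hPF.free x hx).2⟩

/-- Going from a vertex to the one whose partner it is increases the depth, which stays below n, so
the ascent ends at a free vertex. Hence the written paths cover all vertices. -/
theorem exists_free_above (hp : ∀ x y, partner y = some x → RootLT G (compRoot G) x y)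
    (v : Fin n) : ∃ x, (∀ y, partner y ≠ some x) ∧ ChainBelow partner x v := by
  induction hm : n - depth G v using Nat.strong_induction_on generalizing v with
  | _ m ih =>
    by_cases hv : ∀ y, partner y ≠ some v
    · exact ⟨v, hv, Relation.ReflTransGen.refl⟩
    · push Not at hv
      obtain ⟨y, hy⟩ := hv
      obtain ⟨h1, h2, h3⟩ := rootLT_iff.mp (hp v y hy)
      have hpos := h2.pos_dist_of_ne h1
      have := depth_lt G y
      obtain ⟨x, hx, hxy⟩ := ih (n - depth G y) (by omega) y rfl
      exact ⟨x, hx, hxy.tail hy⟩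

/-- The whole algorithm; the number of paths is left in register `16`. -/
def pathCoverCode : Code := .seq computeDepths (.seq auction writePaths)

/-- The algorithm as a machine program. -/
def pathCoverProgram : Program := .seq pathCoverCode.compile (.copy 0 32)

end RAM

theorem mainTheorem8 (t : ℕ) (ht : 1 ≤ t) (𝒢 : GraphClass)
    (h𝒢 : 𝒢.AsymptoticMinorFree (uGraph t)) :
    ∃ (c : ℕ) (A : RAM.Program), IsPolyTimeApproxIsometricPathCover A c 𝒢 := by
  obtain ⟨K, hK⟩ : ∃ K, ∀ n, ∀ G ∈ 𝒢 n, ¬ IsFatMinor (uGraph t) K G := by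
    unfold GraphClass.AsymptoticMinorFree GraphClass.ContainsAsymptoticMinor at h𝒢
    push Not at h𝒢
    obtain ⟨K, -, hK⟩ := h𝒢
    exact ⟨K, hK⟩
  refine ⟨(2 * K + 1) * (8 * t + 2), RAM.pathCoverProgram, RAM.pathCoverCode.cost + 1,
    fun n G hG => ?_⟩
  have h₀ := RAM.hasInput_inputState G
  obtain ⟨T, s, hex, hT, hs⟩ := RAM.pathCoverCode.compile_spec (by decide) (by decide)
    (RAM.inputState G)
  have h₁ := h₀.eval RAM.computeDepths (by decide) (by decide)
  obtain ⟨price, partner, hpart, hinv⟩ := RAM.auction_spec h₁ (RAM.computeDepths_spec h₀)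
  have h₂ := h₁.eval RAM.auction (by decide) (by decide)
  obtain ⟨P, F, hPF⟩ := RAM.writePaths_spec h₂ hpart hinv.edge
  obtain ⟨A, hA, hFA⟩ := hinv.exists_antichain
  change s.evens = RAM.writePaths.eval _ at hs
  rw [← hs] at hPF
  -- The extra step copies the number of paths to register `0`, where the output convention expects
  -- it: variable `16` is machine register `32`.
  refine ⟨T + 1, _, .seq hex (.copy _ _ _), ?_, P, ⟨⟨hPF.isometric, fun v => ?_⟩, fun Q hQ => ?_⟩,
    ?_⟩
  · rw [Polynomial.eval_add, Polynomial.eval_one]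
    simpa [RAM.inputState] using hT
  · obtain ⟨x, hx, hxv⟩ := RAM.exists_free_above hinv.edge v
    obtain ⟨l, hl, hz⟩ := hPF.covers x x.2 hx
    exact ⟨l, hl, hz v hxv⟩
  -- The paths are counted by free vertices, these are bounded by the antichain A, and A is bounded
  -- by any cover.
  · rw [← hPF.card_free]
    exact (hFA F fun x hx => (hPF.free x hx).2).trans
      (card_antichain_le_mul_length (isRootMap_compRoot G) ht (hK n G hG) A hA Q hQ)
  · trans P.map fun l => l.map fun v : Fin n => (v : ℕ)
    swap
    · refine List.map_congr_left fun l _ => ?_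
      simp only [← List.flatMap_pure_eq_map (fun v : Fin n => (v : ℕ)), List.map_id_fun', id_eq]
      rfl
    rw [← hPF.segments]
    simp [RAM.State.output, RAM.State.setReg_reg, RAM.State.setReg_arr, RAM.State.evens,
      RAM.State.segment]
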